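/- Let $m\ge 2$ be an integer and equip $\mathbb R^3$ with the norm $\|x\|_{2m}=(x_1^{2m}+x_2^{2m}+x_3^{2m})^{1/(2m)}$ with unit sphere $S$. For a surface $M$, a local Birkhoff–Gauss map $\eta$ is a smooth map from an open part of $M$ to $S$ such that the tangent plane of $S$ at $\eta(p)$ is parallel to $T_pM$; the mean curvature is $H=\tfrac12\operatorname{trace}(d\eta_p)$, and $M$ is minimal if $H=0$ identically. A translation surface is a surface which, for some ordering $(i,j,k)$ of the coordinates, is a graph $x_k=\varphi(x_i)+\psi(x_j)$ over an open subset of the $(x_i,x_j)$-plane, with $\varphi,\psi$ smooth and $\varphi'\ne0$, $\psi'\neq 0$. Let $W\subset\mathbb R^3$ be open, let $f,g,h$ be smooth functions of one variable on the projections of $W$ to the three coordinate axes, and let $$M=\{x\in W:\ f(x_1)+g(x_2)+h(x_3)=0\}$$ be non-empty and connected with $f'(x_1)g'(x_2)h'(x_3)\ne0$ on $M$. Suppose that $M$ is minimal in $(\mathbb R^3,\|\cdot\|_{2m})$ and is not a translation surface. Then $(f')^{2m/(2m-1)}$, $(g')^{2m/(2m-1)}$, $(h')^{2m/(2m-1)}$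 (the $2m$-th powers of the real $(2m-1)$-st roots) are on $M$ smooth functions $X(u)$, $Y(v)$, $Z(w)$ of $u=f(x_1)$, $v=g(x_2)$, $w=h(x_3)$ respectively. There is a point of $M$ where $X'$, $Y'$, $Z'$ are all non-zero; moreover $X'\ne0$ wherever $f''\neq0$, $Y'\ne0$ wherever $g''\neq0$, and $Z'\ne0$ wherever $h''\ne0$. There is a constant $a\in\mathbb R$ with $$X'''=aX',\qquad Y'''=aY',\qquad Z'''=aZ'$$ for all values $u,v,w$ taken on $M$, so that $X'''/X'=Y'''/Y'=Z'''/Z'=a$ wherever the respective denominators do not vanish. Moreover, on the sets of values $u,v,w$ taken on $M$: (i) If $a>0$, write $a=b^2$ with $b>0$. Then there are real constants $p_i,q_i,r_i$ $(1\le i\le3)$ with $$X=p_1+q_1e^{bu}+r_1e^{-bu},\quad Y=p_2+q_2e^{bv}+r_2e^{-bv},\quad Z=p_3+q_3e^{bw}+r_3e^{-bw},$$ $$\begin{aligned}&(p_2+p_3)r_1-2q_2q_3=0,&&(p_1+p_3)r_2-2q_1q_3=0,&&(p_2+p_3)q_1-2r_2r_3=0,\\&(p_1+p_3)q_2-2r_1r_3=0,&&(p_1+p_2)q_3-2r_1r_2=0,&&(p_1+p_2)r_3-2q_1q_2=0.\end{aligned}$$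 (ii) If $a<0$, write $a=-b^2$ with $b>0$. Then there are real constants $p_i,q_i,r_i$ with $$X=p_1+q_1\cos bu+r_1\sin bu,\quad Y=p_2+q_2\cos bv+r_2\sin bv,\quad Z=p_3+q_3\cos bw+r_3\sin bw,$$ $$\begin{aligned}&(p_2+p_3)q_1-q_2q_3+r_2r_3=0,&&(p_2+p_3)r_1+q_2r_3+q_3r_2=0,\\&(p_1+p_3)q_2-q_1q_3+r_1r_3=0,&&(p_1+p_3)r_2+q_1r_3+q_3r_1=0,\\&(p_1+p_2)q_3-q_1q_2+r_1r_2=0,&&(p_1+p_2)r_3+q_1r_2+q_2r_1=0.\end{aligned}$$ (iii) If $a=0$, there are real constants $p_i,q_i,r_i$ with $$X=p_1+q_1u+r_1u^2,\quad Y=p_2+q_2v+r_2v^2,\quad Z=p_3+q_3w+r_3w^2,$$ $$\begin{aligned}&(p_2+p_3)q_1+(p_1+p_3)q_2+(p_1+p_2)q_3=0,\\&2(p_2+p_3)r_1-2(p_1+p_2)r_3+q_2(q_1-q_3)=0,\\&2(p_1+p_3)r_2-2(p_1+p_2)r_3+q_1(q_2-q_3)=0,\\&(q_2-q_3)r_1-(q_1-q_2)r_3=0,\qquad(q_1-q_3)r_2+(q_1-q_2)r_3=0,\\&r_1r_2+r_1r_3+r_2r_3=0.\end{aligned}$$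 -/

import Mathlib

open scoped ENNReal ContDiff Topology

noncomputable section

section NormedSpaceSurfaces

variable {E : Type*} [NormedAddCommGroup E] [NormedSpace ℝ E]

/-- The tangent plane (as a linear subspace) of a subset `M` of `E` at `p`: the span of all
tangent directions of `M` at `p`. For a regular surface this is the usual tangent plane. -/
def tangentPlane (M : Set E) (p : E) : Submodule ℝ E :=
  Submodule.span ℝ (tangentConeAt ℝ M p)

/-- `v` is Birkhoff orthogonal to (a plane with direction) `P`: `v ≠ 0` and the tangent plane of
the unit sphere at `v / ‖v‖` is parallel to `P`. -/
def BirkhoffOrthogonal (v : E) (P : Submodule ℝ E) : Prop :=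
  v ≠ 0 ∧ tangentPlane (Metric.sphere (0 : E) 1) (‖v‖⁻¹ • v) = P

/-- `η` is a smooth Birkhoff-Gauss map of the surface `M`: it takes values in the unit sphere, and
`η p` is Birkhoff orthogonal to the tangent plane of `M` at `p`, for all `p ∈ M`. -/
def IsBirkhoffGaussMap (M : Set E) (η : E → E) : Prop :=
  ContDiffOn ℝ ∞ η M ∧ ∀ p ∈ M, ‖η p‖ = 1 ∧ BirkhoffOrthogonal (η p) (tangentPlane M p)

/-- `M` has mean curvature `H = (1/2) trace (dη_p)` at `p` with respect to the Birkhoff-Gauss map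
`η`. Here `dη_p` is the endomorphism of the tangent plane of `M` at `p` given by the derivative of
`η` along `M` (a derivative `L` of `η` within `M` is determined on the tangent plane). -/
def HasMeanCurvatureAt (M : Set E) (η : E → E) (p : E) (H : ℝ) : Prop :=
  ∃ L : E →L[ℝ] E, HasFDerivWithinAt η L M p ∧
    ∃ hL : ∀ v ∈ tangentPlane M p, (L : E →ₗ[ℝ] E) v ∈ tangentPlane M p,
      H = (1 / 2) * LinearMap.trace ℝ (tangentPlane M p) ((L : E →ₗ[ℝ] E).restrict hL)

/-- `M` is minimal: its mean curvature, computed with local Birkhoff-Gauss maps, vanishes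
identically. -/
def IsMinimalSurface (M : Set E) : Prop :=
  ∀ p ∈ M, ∃ U : Set E, IsOpen U ∧ p ∈ U ∧ ∃ η : E → E,
    IsBirkhoffGaussMap (M ∩ U) η ∧ ∀ q ∈ M ∩ U, HasMeanCurvatureAt (M ∩ U) η q 0

end NormedSpaceSurfaces

instance fact_one_le_two_mul (m : ℕ) [hm : Fact (2 ≤ m)] :
    Fact ((1 : ℝ≥0∞) ≤ ((2 * m : ℕ) : ℝ≥0∞)) :=
  ⟨by
    have h : 1 ≤ 2 * m := by have := hm.out; omega
    exact_mod_cast h⟩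

/-- The space `ℝ³` with the norm `‖x‖ = (x₁ ^ (2m) + x₂ ^ (2m) + x₃ ^ (2m)) ^ (1 / (2m))`;
the coordinates are `x 0`, `x 1`, `x 2`. -/
abbrev Space2m (m : ℕ) : Type := PiLp ((2 * m : ℕ) : ℝ≥0∞) (fun _ : Fin 3 => ℝ)

/-- The implicit surface `f(x₁) + g(x₂) + h(x₃) = 0` in the open set `W`. -/
def separableSurface {m : ℕ} (W : Set (Space2m m)) (f g h : ℝ → ℝ) : Set (Space2m m) :=
  {x | x ∈ W ∧ f (x 0) + g (x 1) + h (x 2) = 0}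

/-- `M` is a translation surface: for some ordering `i, j, k` of the coordinates it is the graph
`x_k = φ(x_i) + ψ(x_j)` over an open set `D` of the `(x_i, x_j)`-plane, where `φ`, `ψ` are smooth
with nowhere vanishing derivatives. -/
def IsTranslationSurface {m : ℕ} (M : Set (Space2m m)) : Prop :=
  ∃ i j k : Fin 3, i ≠ j ∧ j ≠ k ∧ i ≠ k ∧
    ∃ (D : Set (ℝ × ℝ)) (φ ψ : ℝ → ℝ), IsOpen D ∧
      ContDiffOn ℝ ∞ φ (Prod.fst '' D) ∧ ContDiffOn ℝ ∞ ψ (Prod.snd '' D) ∧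
      (∀ d ∈ D, deriv φ d.1 ≠ 0 ∧ deriv ψ d.2 ≠ 0) ∧
      M = {x | (x i, x j) ∈ D ∧ x k = φ (x i) + ψ (x j)}

/-- The real root `t ^ (1 / n)` for odd `n`, with `(-t) ^ (1 / n) = -(t ^ (1 / n))`. -/
def oddRoot (n : ℕ) (t : ℝ) : ℝ := (SignType.sign t : ℝ) * |t| ^ (1 / (n : ℝ))

/-- The real power `t ^ (2m / (2m - 1))`, that is, the `2m`-th power of the real
`(2m - 1)`-st root of `t` (which is defined for negative `t` too). -/
def evenOddPow (m : ℕ) (t : ℝ) : ℝ := oddRoot (2 * m - 1) t ^ (2 * m)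

/-- Conditions on the coefficients in the exponential case. -/
def ExpCoeffs (p q r : Fin 3 → ℝ) : Prop :=
  (p 1 + p 2) * r 0 - 2 * q 1 * q 2 = 0 ∧
  (p 0 + p 2) * r 1 - 2 * q 0 * q 2 = 0 ∧
  (p 1 + p 2) * q 0 - 2 * r 1 * r 2 = 0 ∧
  (p 0 + p 2) * q 1 - 2 * r 0 * r 2 = 0 ∧
  (p 0 + p 1) * q 2 - 2 * r 0 * r 1 = 0 ∧
  (p 0 + p 1) * r 2 - 2 * q 0 * q 1 = 0

/-- Conditions on the coefficients in the trigonometric case. -/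
def TrigCoeffs (p q r : Fin 3 → ℝ) : Prop :=
  (p 1 + p 2) * q 0 - q 1 * q 2 + r 1 * r 2 = 0 ∧
  (p 1 + p 2) * r 0 + q 1 * r 2 + q 2 * r 1 = 0 ∧
  (p 0 + p 2) * q 1 - q 0 * q 2 + r 0 * r 2 = 0 ∧
  (p 0 + p 2) * r 1 + q 0 * r 2 + q 2 * r 0 = 0 ∧
  (p 0 + p 1) * q 2 - q 0 * q 1 + r 0 * r 1 = 0 ∧
  (p 0 + p 1) * r 2 + q 0 * r 1 + q 1 * r 0 = 0

/-- Conditions on the coefficients in the quadratic case. -/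
def QuadCoeffs (p q r : Fin 3 → ℝ) : Prop :=
  (p 1 + p 2) * q 0 + (p 0 + p 2) * q 1 + (p 0 + p 1) * q 2 = 0 ∧
  2 * (p 1 + p 2) * r 0 - 2 * (p 0 + p 1) * r 2 + q 1 * (q 0 - q 2) = 0 ∧
  2 * (p 0 + p 2) * r 1 - 2 * (p 0 + p 1) * r 2 + q 0 * (q 1 - q 2) = 0 ∧
  (q 1 - q 2) * r 0 - (q 0 - q 1) * r 2 = 0 ∧
  (q 0 - q 2) * r 1 + (q 0 - q 1) * r 2 = 0 ∧
  r 0 * r 1 + r 0 * r 2 + r 1 * r 2 = 0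

end

/-! Write `A₁`, `A₂`, `A₃` for the `(2m-1)`-st roots of `f'`, `g'`, `h'`. The sphere at `η` has
normal direction `(ηᵢ ^ (2m-1))`, so a Birkhoff–Gauss map of the level set is, up to a locally
constant sign, the vector `(A₁, A₂, A₃)` scaled to norm one. Its trace vanishes exactly when `∑ Aᵢ'
(S - Aᵢ ^ (2m)) = 0`, where `S = ∑ Aⱼ ^ (2m)` (`minimal_separable_equation`). As a function of `u =
f(x₁)`, the power `X = A₁ ^ (2m)` has derivative `2m A₁ ^ (2m-1) A₁' / f' = 2m A₁'`, so minimality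
becomes `X' (Y + Z) + Y' (X + Z) + Z' (X + Y) = 0` on an open part of the plane `u + v + w = 0`.

Differentiating twice along this plane and eliminating second derivatives yields `X''' = κ X'`,
`Y''' = κ Y'`, `Z''' = κ Z'` with a single explicit function `κ` (`eq_commonRatio_mul`). Where `X' ≠
0`, `κ` depends on `u` alone, and similarly for `v` and `w`. Positivity of `X`, `Y`, `Z` prevents
exactly one first derivative from being nonzero, so `κ` has zero differential wherever some first
derivative is nonzero. On open sets where all three vanish the formula gives `κ = 0`. By continuity
and connectedness `κ` is a constant `a` (`exists_common_ratio`).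

The sign of `a` selects exponentials, trigonometric functions or quadratics, and the differentiated
relations give the coefficient conditions (`functional_equation_solutions`). If one of `X'`, `Y'`,
`Z'` vanished identically, the corresponding function would be affine and `M` a translation surface;
unique continuation then provides a point where none of them vanishes. -/

/-- A function vanishing on an open set has zero derivative there. -/
theorem HasFDerivAt.eq_zero_of_eqOn_zero {P : ℝ × ℝ → ℝ} {Ω : Set (ℝ × ℝ)} (hΩ : IsOpen Ω)
    (hP : ∀ p ∈ Ω, P p = 0) {p : ℝ × ℝ} (hp : p ∈ Ω) {L : ℝ × ℝ →L[ℝ] ℝ}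
    (hL : HasFDerivAt P L p) : L = 0 := by
  have h0 : P =ᶠ[𝓝 p] fun _ => 0 := by
    filter_upwards [hΩ.mem_nhds hp] with q hq using hP q hq
  exact hL.unique ((hasFDerivAt_const (0 : ℝ) p).congr_of_eventuallyEq h0)

/-! ### Functions of `u`, `v` or `w = -u - v` as functions on the `(u, v)`-plane. -/

theorem HasDerivAt.comp_fst_hasFDerivAt {X : ℝ → ℝ} {c : ℝ} {p : ℝ × ℝ}
    (h : HasDerivAt X c p.1) :
    HasFDerivAt (fun q : ℝ × ℝ => X q.1) (c • ContinuousLinearMap.fst ℝ ℝ ℝ) p :=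
  h.comp_hasFDerivAt p hasFDerivAt_fst

theorem HasDerivAt.comp_snd_hasFDerivAt {X : ℝ → ℝ} {c : ℝ} {p : ℝ × ℝ}
    (h : HasDerivAt X c p.2) :
    HasFDerivAt (fun q : ℝ × ℝ => X q.2) (c • ContinuousLinearMap.snd ℝ ℝ ℝ) p :=
  h.comp_hasFDerivAt p hasFDerivAt_snd

theorem HasDerivAt.comp_neg_sub_hasFDerivAt {X : ℝ → ℝ} {c : ℝ} {p : ℝ × ℝ}
    (h : HasDerivAt X c (-p.1 - p.2)) :
    HasFDerivAt (fun q : ℝ × ℝ => X (-q.1 - q.2))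
      (c • (-ContinuousLinearMap.fst ℝ ℝ ℝ - ContinuousLinearMap.snd ℝ ℝ ℝ)) p :=
  h.comp_hasFDerivAt p (hasFDerivAt_fst.neg.sub hasFDerivAt_snd)

/-! ### Differentiating the functional equation on `u + v + w = 0`. -/

section FunctionalEquation

variable {Ω : Set (ℝ × ℝ)} {X₀ X₁ X₂ X₃ Y₀ Y₁ Y₂ Y₃ Z₀ Z₁ Z₂ Z₃ : ℝ → ℝ}

/-- First derivatives of the functional equation. -/
theorem second_deriv_relations (hΩ : IsOpen Ω)
    (hX₀ : ∀ p ∈ Ω, HasDerivAt X₀ (X₁ p.1) p.1) (hX₁ : ∀ p ∈ Ω, HasDerivAt X₁ (X₂ p.1) p.1)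
    (hY₀ : ∀ p ∈ Ω, HasDerivAt Y₀ (Y₁ p.2) p.2) (hY₁ : ∀ p ∈ Ω, HasDerivAt Y₁ (Y₂ p.2) p.2)
    (hZ₀ : ∀ p ∈ Ω, HasDerivAt Z₀ (Z₁ (-p.1 - p.2)) (-p.1 - p.2))
    (hZ₁ : ∀ p ∈ Ω, HasDerivAt Z₁ (Z₂ (-p.1 - p.2)) (-p.1 - p.2))
    (hE : ∀ p ∈ Ω, X₁ p.1 * (Y₀ p.2 + Z₀ (-p.1 - p.2)) + Y₁ p.2 * (X₀ p.1 + Z₀ (-p.1 - p.2)) +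
      Z₁ (-p.1 - p.2) * (X₀ p.1 + Y₀ p.2) = 0) :
    ∀ p ∈ Ω,
      X₂ p.1 * (Y₀ p.2 + Z₀ (-p.1 - p.2)) - Y₂ p.2 * (X₀ p.1 + Z₀ (-p.1 - p.2)) +
        Z₁ (-p.1 - p.2) * (X₁ p.1 - Y₁ p.2) = 0 ∧
      Y₂ p.2 * (X₀ p.1 + Z₀ (-p.1 - p.2)) - Z₂ (-p.1 - p.2) * (X₀ p.1 + Y₀ p.2) +
        X₁ p.1 * (Y₁ p.2 - Z₁ (-p.1 - p.2)) = 0 := by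
  intro p hp
  have hx₀ := (hX₀ p hp).comp_fst_hasFDerivAt
  have hx₁ := (hX₁ p hp).comp_fst_hasFDerivAt
  have hy₀ := (hY₀ p hp).comp_snd_hasFDerivAt
  have hy₁ := (hY₁ p hp).comp_snd_hasFDerivAt
  have hz₀ := (hZ₀ p hp).comp_neg_sub_hasFDerivAt
  have hz₁ := (hZ₁ p hp).comp_neg_sub_hasFDerivAt
  have key := (((hx₁.mul (hy₀.add hz₀)).add (hy₁.mul (hx₀.add hz₀))).add
    (hz₁.mul (hx₀.add hy₀))).eq_zero_of_eqOn_zero hΩ hE hp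
  -- The direction `(1, -1)` keeps `w` fixed and `(0, 1)` keeps `u` fixed, so each relation involves
  -- only two of the three second derivatives.
  have k₁ := congrArg (fun L : ℝ × ℝ →L[ℝ] ℝ => L (1, -1)) key
  have k₂ := congrArg (fun L : ℝ × ℝ →L[ℝ] ℝ => L (0, 1)) key
  simp at k₁ k₂
  constructor
  · linear_combination k₁
  · linear_combination k₂

/-- Second derivatives of the functional equation. -/
theorem third_deriv_relations (hΩ : IsOpen Ω)
    (hX₀ : ∀ p ∈ Ω, HasDerivAt X₀ (X₁ p.1) p.1) (hX₁ : ∀ p ∈ Ω, HasDerivAt X₁ (X₂ p.1) p.1)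
    (hX₂ : ∀ p ∈ Ω, HasDerivAt X₂ (X₃ p.1) p.1)
    (hY₀ : ∀ p ∈ Ω, HasDerivAt Y₀ (Y₁ p.2) p.2) (hY₁ : ∀ p ∈ Ω, HasDerivAt Y₁ (Y₂ p.2) p.2)
    (hY₂ : ∀ p ∈ Ω, HasDerivAt Y₂ (Y₃ p.2) p.2)
    (hZ₀ : ∀ p ∈ Ω, HasDerivAt Z₀ (Z₁ (-p.1 - p.2)) (-p.1 - p.2))
    (hZ₁ : ∀ p ∈ Ω, HasDerivAt Z₁ (Z₂ (-p.1 - p.2)) (-p.1 - p.2))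
    (hZ₂ : ∀ p ∈ Ω, HasDerivAt Z₂ (Z₃ (-p.1 - p.2)) (-p.1 - p.2))
    (hE : ∀ p ∈ Ω, X₁ p.1 * (Y₀ p.2 + Z₀ (-p.1 - p.2)) + Y₁ p.2 * (X₀ p.1 + Z₀ (-p.1 - p.2)) +
      Z₁ (-p.1 - p.2) * (X₀ p.1 + Y₀ p.2) = 0) :
    ∀ p ∈ Ω,
      X₃ p.1 * (Y₀ p.2 + Z₀ (-p.1 - p.2)) =
        Y₂ p.2 * (X₁ p.1 - Z₁ (-p.1 - p.2)) + Z₂ (-p.1 - p.2) * (X₁ p.1 - Y₁ p.2) ∧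
      Y₃ p.2 * (X₀ p.1 + Z₀ (-p.1 - p.2)) =
        X₂ p.1 * (Y₁ p.2 - Z₁ (-p.1 - p.2)) + Z₂ (-p.1 - p.2) * (Y₁ p.2 - X₁ p.1) ∧
      Z₃ (-p.1 - p.2) * (X₀ p.1 + Y₀ p.2) =
        X₂ p.1 * (Z₁ (-p.1 - p.2) - Y₁ p.2) + Y₂ p.2 * (Z₁ (-p.1 - p.2) - X₁ p.1) := by
  have hF := second_deriv_relations hΩ hX₀ hX₁ hY₀ hY₁ hZ₀ hZ₁ hE
  intro p hp
  have hx₀ := (hX₀ p hp).comp_fst_hasFDerivAt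
  have hx₁ := (hX₁ p hp).comp_fst_hasFDerivAt
  have hx₂ := (hX₂ p hp).comp_fst_hasFDerivAt
  have hy₀ := (hY₀ p hp).comp_snd_hasFDerivAt
  have hy₁ := (hY₁ p hp).comp_snd_hasFDerivAt
  have hy₂ := (hY₂ p hp).comp_snd_hasFDerivAt
  have hz₀ := (hZ₀ p hp).comp_neg_sub_hasFDerivAt
  have hz₁ := (hZ₁ p hp).comp_neg_sub_hasFDerivAt
  have hz₂ := (hZ₂ p hp).comp_neg_sub_hasFDerivAt
  have key₁ := (((hx₂.mul (hy₀.add hz₀)).sub (hy₂.mul (hx₀.add hz₀))).add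
    (hz₁.mul (hx₁.sub hy₁))).eq_zero_of_eqOn_zero hΩ (fun q hq => (hF q hq).1) hp
  have key₂ := (((hy₂.mul (hx₀.add hz₀)).sub (hz₂.mul (hx₀.add hy₀))).add
    (hx₁.mul (hy₁.sub hz₁))).eq_zero_of_eqOn_zero hΩ (fun q hq => (hF q hq).2) hp
  -- Each relation is differentiated again with a different variable held fixed. Only one variable
  -- then moves in both differentiations, so only its third derivative appears.
  have k₁ := congrArg (fun L : ℝ × ℝ →L[ℝ] ℝ => L (0, 1)) key₁
  have k₂ := congrArg (fun L : ℝ × ℝ →L[ℝ] ℝ => L (1, 0)) key₁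
  have k₃ := congrArg (fun L : ℝ × ℝ →L[ℝ] ℝ => L (1, 0)) key₂
  simp at k₁ k₂ k₃
  refine ⟨?_, ?_, ?_⟩
  · linear_combination k₂
  · linear_combination -k₁
  · linear_combination k₃

/-- The common ratio of the third and the first derivatives of a solution of the functional
equation, in terms of the lower derivatives. -/
noncomputable def commonRatio (x₀ x₁ x₂ y₀ y₁ z₀ z₁ : ℝ) : ℝ :=
  (((y₀ + z₀) * x₂ - y₁ * z₁) * ((y₀ + z₀) + (x₀ + z₀) + (x₀ + y₀)) -
    x₁ ^ 2 * (y₀ + z₀) - y₁ ^ 2 * (x₀ + z₀) - z₁ ^ 2 * (x₀ + y₀)) /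
    ((y₀ + z₀) * (x₀ + z₀) * (x₀ + y₀))

/-- With `α = y₀ + z₀`, `β = x₀ + z₀`, `γ = x₀ + y₀`, the relations `hF₁`, `hF₂` say that `α x₂ - y₁
z₁ = β y₂ - x₁ z₁ = γ z₂ - x₁ y₁`. Expressing all second derivatives through this common value `s`
makes the ratio symmetric in the three functions, and each claim becomes a third-order relation plus
a multiple of `hE`. -/
theorem eq_commonRatio_mul {x₀ x₁ x₂ x₃ y₀ y₁ y₂ y₃ z₀ z₁ z₂ z₃ : ℝ}
    (hx : 0 < x₀) (hy : 0 < y₀) (hz : 0 < z₀)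
    (hE : x₁ * (y₀ + z₀) + y₁ * (x₀ + z₀) + z₁ * (x₀ + y₀) = 0)
    (hF₁ : x₂ * (y₀ + z₀) - y₂ * (x₀ + z₀) + z₁ * (x₁ - y₁) = 0)
    (hF₂ : y₂ * (x₀ + z₀) - z₂ * (x₀ + y₀) + x₁ * (y₁ - z₁) = 0)
    (hG₁ : x₃ * (y₀ + z₀) = y₂ * (x₁ - z₁) + z₂ * (x₁ - y₁))
    (hG₂ : y₃ * (x₀ + z₀) = x₂ * (y₁ - z₁) + z₂ * (y₁ - x₁))
    (hG₃ : z₃ * (x₀ + y₀) = x₂ * (z₁ - y₁) + y₂ * (z₁ - x₁)) :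
    x₃ = commonRatio x₀ x₁ x₂ y₀ y₁ z₀ z₁ * x₁ ∧
    y₃ = commonRatio x₀ x₁ x₂ y₀ y₁ z₀ z₁ * y₁ ∧
    z₃ = commonRatio x₀ x₁ x₂ y₀ y₁ z₀ z₁ * z₁ := by
  unfold commonRatio
  obtain ⟨α, hα⟩ : ∃ α, α = y₀ + z₀ := ⟨_, rfl⟩
  obtain ⟨β, hβ⟩ : ∃ β, β = x₀ + z₀ := ⟨_, rfl⟩
  obtain ⟨γ, hγ⟩ : ∃ γ, γ = x₀ + y₀ := ⟨_, rfl⟩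
  have pα : α ≠ 0 := by rw [hα]; positivity
  have pβ : β ≠ 0 := by rw [hβ]; positivity
  have pγ : γ ≠ 0 := by rw [hγ]; positivity
  rw [← hα] at hE hF₁ hG₁ ⊢
  rw [← hβ] at hE hF₁ hF₂ hG₂ ⊢
  rw [← hγ] at hE hF₂ hG₃ ⊢
  have e₂ : y₂ = ((α * x₂ - y₁ * z₁) + x₁ * z₁) / β := by
    rw [eq_div_iff pβ]; linear_combination -hF₁
  have e₃ : z₂ = ((α * x₂ - y₁ * z₁) + x₁ * y₁) / γ := by
    rw [eq_div_iff pγ]; linear_combination -hF₁ - hF₂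
  have f₁ : x₂ = ((α * x₂ - y₁ * z₁) + y₁ * z₁) / α := by field_simp; ring
  generalize α * x₂ - y₁ * z₁ = s at e₂ e₃ f₁ ⊢
  rw [f₁] at hG₂ hG₃
  rw [e₂] at hG₁ hG₃
  rw [e₃] at hG₁ hG₂
  refine ⟨?_, ?_, ?_⟩
  · rw [div_mul_eq_mul_div, eq_div_iff (by positivity)]
    field_simp at hG₁
    linear_combination hG₁ + (-s + x₁ ^ 2) * hE
  · rw [div_mul_eq_mul_div, eq_div_iff (by positivity)]
    field_simp at hG₂
    linear_combination hG₂ + (-s + y₁ ^ 2) * hE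
  · rw [div_mul_eq_mul_div, eq_div_iff (by positivity)]
    field_simp at hG₃
    linear_combination hG₃ + (-s + z₁ ^ 2) * hE

end FunctionalEquation

/-! ### The common ratio is constant. -/

theorem ContDiffAt.deriv_of_infty {X : ℝ → ℝ} {u : ℝ} (h : ContDiffAt ℝ ∞ X u) :
    ContDiffAt ℝ ∞ (deriv X) u := by
  have : ContDiffAt ℝ ∞ (fun t => fderiv ℝ X t 1) u :=
    (h.fderiv_right (m := ∞) (by simp)).clm_apply contDiffAt_const
  exact this

theorem ContDiffAt.hasDerivAt_of_infty {X : ℝ → ℝ} {u : ℝ} (h : ContDiffAt ℝ ∞ X u) :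
    HasDerivAt X (deriv X u) u :=
  (h.differentiableAt (by simp)).hasDerivAt

/-- A `C¹` function on a connected open set of the plane, whose derivative vanishes on `B` and
which vanishes on the interior of the complement of `B`, is constant. -/
theorem constant_of_fderiv_eq_zero_or {Ω : Set (ℝ × ℝ)} (hΩ : IsOpen Ω) (hc : IsPreconnected Ω)
    {κ : ℝ × ℝ → ℝ} (hκ : ContDiffOn ℝ ∞ κ Ω) {B : Set (ℝ × ℝ)}
    (hB : ∀ p ∈ Ω, p ∈ B → fderiv ℝ κ p = 0)
    (h0 : ∀ p ∈ Ω, (∀ᶠ q in 𝓝 p, q ∉ B) → κ p = 0) :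
    ∀ p ∈ Ω, ∀ q ∈ Ω, κ p = κ q := by
  have hd : ∀ p ∈ Ω, fderiv ℝ κ p = 0 := by
    intro p hp
    -- Either `B` accumulates at `p` and continuity carries the vanishing of the derivative over to
    -- `p`, or `κ` is zero near `p`.
    by_cases hpB : ∃ᶠ q in 𝓝 p, q ∈ B
    · have hcont : ContinuousAt (fderiv ℝ κ) p :=
        (hκ.continuousOn_fderiv_of_isOpen hΩ (by simp)).continuousAt (hΩ.mem_nhds hp)
      by_contra hne
      have := hcont.eventually_ne hne
      obtain ⟨q, hqB, hq, hqΩ⟩ := (hpB.and_eventually (this.and (hΩ.mem_nhds hp))).exists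
      exact hq (hB q hqΩ hqB)
    · rw [Filter.not_frequently] at hpB
      have : κ =ᶠ[𝓝 p] fun _ => 0 := by
        filter_upwards [hpB.eventually_nhds, hΩ.mem_nhds hp] with q hq hqΩ using h0 q hqΩ hq
      rw [this.fderiv_eq]
      simp
  intro p hp q hq
  exact hΩ.is_const_of_fderiv_eq_zero hc (hκ.differentiableOn (by simp)) (fun x hx => hd x hx) hp hq

/-- Positive smooth solutions of the functional equation satisfy a common linear ODE. -/
theorem exists_common_ratio {Ω : Set (ℝ × ℝ)} (hΩ : IsOpen Ω) (hc : IsPreconnected Ω)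
    {X Y Z : ℝ → ℝ} (hX : ∀ p ∈ Ω, ContDiffAt ℝ ∞ X p.1) (hY : ∀ p ∈ Ω, ContDiffAt ℝ ∞ Y p.2)
    (hZ : ∀ p ∈ Ω, ContDiffAt ℝ ∞ Z (-p.1 - p.2))
    (hX0 : ∀ p ∈ Ω, 0 < X p.1) (hY0 : ∀ p ∈ Ω, 0 < Y p.2) (hZ0 : ∀ p ∈ Ω, 0 < Z (-p.1 - p.2))
    (hE : ∀ p ∈ Ω, deriv X p.1 * (Y p.2 + Z (-p.1 - p.2)) +
      deriv Y p.2 * (X p.1 + Z (-p.1 - p.2)) + deriv Z (-p.1 - p.2) * (X p.1 + Y p.2) = 0) :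
    ∃ a : ℝ, ∀ p ∈ Ω, deriv (deriv (deriv X)) p.1 = a * deriv X p.1 ∧
      deriv (deriv (deriv Y)) p.2 = a * deriv Y p.2 ∧
      deriv (deriv (deriv Z)) (-p.1 - p.2) = a * deriv Z (-p.1 - p.2) := by
  have hX1 := fun p hp => (hX p hp).deriv_of_infty
  have hX2 := fun p hp => (hX1 p hp).deriv_of_infty
  have hX3 := fun p hp => (hX2 p hp).deriv_of_infty
  have hY1 := fun p hp => (hY p hp).deriv_of_infty
  have hY2 := fun p hp => (hY1 p hp).deriv_of_infty
  have hY3 := fun p hp => (hY2 p hp).deriv_of_infty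
  have hZ1 := fun p hp => (hZ p hp).deriv_of_infty
  have hZ2 := fun p hp => (hZ1 p hp).deriv_of_infty
  have hZ3 := fun p hp => (hZ2 p hp).deriv_of_infty
  have hF := second_deriv_relations hΩ (fun p hp => (hX p hp).hasDerivAt_of_infty)
    (fun p hp => (hX1 p hp).hasDerivAt_of_infty) (fun p hp => (hY p hp).hasDerivAt_of_infty)
    (fun p hp => (hY1 p hp).hasDerivAt_of_infty) (fun p hp => (hZ p hp).hasDerivAt_of_infty)
    (fun p hp => (hZ1 p hp).hasDerivAt_of_infty) hE
  have hG := third_deriv_relations hΩ (fun p hp => (hX p hp).hasDerivAt_of_infty)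
    (fun p hp => (hX1 p hp).hasDerivAt_of_infty) (fun p hp => (hX2 p hp).hasDerivAt_of_infty)
    (fun p hp => (hY p hp).hasDerivAt_of_infty) (fun p hp => (hY1 p hp).hasDerivAt_of_infty)
    (fun p hp => (hY2 p hp).hasDerivAt_of_infty) (fun p hp => (hZ p hp).hasDerivAt_of_infty)
    (fun p hp => (hZ1 p hp).hasDerivAt_of_infty) (fun p hp => (hZ2 p hp).hasDerivAt_of_infty) hE
  obtain ⟨κ, hκdef⟩ : ∃ κ : ℝ × ℝ → ℝ, κ = fun p => commonRatio (X p.1) (deriv X p.1)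
      (deriv (deriv X) p.1) (Y p.2) (deriv Y p.2) (Z (-p.1 - p.2)) (deriv Z (-p.1 - p.2)) :=
    ⟨_, rfl⟩
  have hκ : ∀ p ∈ Ω, deriv (deriv (deriv X)) p.1 = κ p * deriv X p.1 ∧
      deriv (deriv (deriv Y)) p.2 = κ p * deriv Y p.2 ∧
      deriv (deriv (deriv Z)) (-p.1 - p.2) = κ p * deriv Z (-p.1 - p.2) := by
    intro p hp
    rw [hκdef]
    exact eq_commonRatio_mul (hX0 p hp) (hY0 p hp) (hZ0 p hp) (hE p hp) (hF p hp).1 (hF p hp).2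
      (hG p hp).1 (hG p hp).2.1 (hG p hp).2.2
  have hsmooth : ∀ p ∈ Ω, ContDiffAt ℝ ∞ κ p := by
    intro p hp
    have x0 : ContDiffAt ℝ ∞ (fun q : ℝ × ℝ => X q.1) p := (hX p hp).comp p contDiffAt_fst
    have x1 : ContDiffAt ℝ ∞ (fun q : ℝ × ℝ => deriv X q.1) p := (hX1 p hp).comp p contDiffAt_fst
    have x2 : ContDiffAt ℝ ∞ (fun q : ℝ × ℝ => deriv (deriv X) q.1) p :=
      (hX2 p hp).comp p contDiffAt_fst
    have y0 : ContDiffAt ℝ ∞ (fun q : ℝ × ℝ => Y q.2) p := (hY p hp).comp p contDiffAt_snd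
    have y1 : ContDiffAt ℝ ∞ (fun q : ℝ × ℝ => deriv Y q.2) p := (hY1 p hp).comp p contDiffAt_snd
    have hw : ContDiffAt ℝ ∞ (fun q : ℝ × ℝ => -q.1 - q.2) p := by fun_prop
    have z0 : ContDiffAt ℝ ∞ (fun q : ℝ × ℝ => Z (-q.1 - q.2)) p := (hZ p hp).comp p hw
    have z1 : ContDiffAt ℝ ∞ (fun q : ℝ × ℝ => deriv Z (-q.1 - q.2)) p :=
      ContDiffAt.comp (g := deriv Z) p (hZ1 p hp) hw
    have hx := hX0 p hp
    have hy := hY0 p hp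
    have hz := hZ0 p hp
    rw [hκdef]
    unfold commonRatio
    refine ContDiffAt.div (((((((y0.add z0).mul x2).sub (y1.mul z1)).mul
      (((y0.add z0).add (x0.add z0)).add (x0.add y0))).sub ((x1.pow 2).mul (y0.add z0))).sub
      ((y1.pow 2).mul (x0.add z0))).sub ((z1.pow 2).mul (x0.add y0)))
      (((y0.add z0).mul (x0.add z0)).mul (x0.add y0)) (by positivity)
  -- Differentiating `X''' = κ X'` with `u` fixed leaves `X' ∂κ = 0`; the next two facts do the same
  -- with `v` and `w` fixed.
  have hdx : ∀ p ∈ Ω, deriv X p.1 ≠ 0 → fderiv ℝ κ p (0, 1) = 0 := by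
    intro p hp hne
    have hκd := ((hsmooth p hp).differentiableAt (by simp)).hasFDerivAt
    have := (((hX3 p hp).hasDerivAt_of_infty.comp_fst_hasFDerivAt).sub
      (hκd.mul ((hX1 p hp).hasDerivAt_of_infty.comp_fst_hasFDerivAt))).eq_zero_of_eqOn_zero hΩ
      (fun q hq => sub_eq_zero.2 (hκ q hq).1) hp
    have := congrArg (fun L : ℝ × ℝ →L[ℝ] ℝ => L (0, 1)) this
    simpa [hne] using this
  have hdy : ∀ p ∈ Ω, deriv Y p.2 ≠ 0 → fderiv ℝ κ p (1, 0) = 0 := by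
    intro p hp hne
    have hκd := ((hsmooth p hp).differentiableAt (by simp)).hasFDerivAt
    have := (((hY3 p hp).hasDerivAt_of_infty.comp_snd_hasFDerivAt).sub
      (hκd.mul ((hY1 p hp).hasDerivAt_of_infty.comp_snd_hasFDerivAt))).eq_zero_of_eqOn_zero hΩ
      (fun q hq => sub_eq_zero.2 (hκ q hq).2.1) hp
    have := congrArg (fun L : ℝ × ℝ →L[ℝ] ℝ => L (1, 0)) this
    simpa [hne] using this
  have hdz : ∀ p ∈ Ω, deriv Z (-p.1 - p.2) ≠ 0 → fderiv ℝ κ p (1, -1) = 0 := by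
    intro p hp hne
    have hκd := ((hsmooth p hp).differentiableAt (by simp)).hasFDerivAt
    have := (((hZ3 p hp).hasDerivAt_of_infty.comp_neg_sub_hasFDerivAt).sub
      (hκd.mul ((hZ1 p hp).hasDerivAt_of_infty.comp_neg_sub_hasFDerivAt))).eq_zero_of_eqOn_zero hΩ
      (fun q hq => sub_eq_zero.2 (hκ q hq).2.2) hp
    have := congrArg (fun L : ℝ × ℝ →L[ℝ] ℝ => L (1, -1)) this
    simpa [hne] using this
  have hconst := constant_of_fderiv_eq_zero_or hΩ hc (κ := κ)
    (fun p hp => (hsmooth p hp).contDiffWithinAt)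
    (B := {p | deriv X p.1 ≠ 0 ∨ deriv Y p.2 ≠ 0 ∨ deriv Z (-p.1 - p.2) ≠ 0}) ?_ ?_
  · rcases Ω.eq_empty_or_nonempty with h | ⟨p₀, hp₀⟩
    · exact ⟨0, by simp [h]⟩
    · refine ⟨κ p₀, fun p hp => ?_⟩
      rw [hconst p₀ hp₀ p hp]
      exact hκ p hp
  -- The coefficients in `hE` are positive, so one nonzero first derivative forces a second. The
  -- corresponding two directions span the plane.
  · intro p hp hpB
    have hE' := hE p hp
    have px : Y p.2 + Z (-p.1 - p.2) ≠ 0 := (add_pos (hY0 p hp) (hZ0 p hp)).ne'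
    have py : X p.1 + Z (-p.1 - p.2) ≠ 0 := (add_pos (hX0 p hp) (hZ0 p hp)).ne'
    have pz : X p.1 + Y p.2 ≠ 0 := (add_pos (hX0 p hp) (hY0 p hp)).ne'
    have hlin : fderiv ℝ κ p (1, -1) = fderiv ℝ κ p (1, 0) - fderiv ℝ κ p (0, 1) := by
      rw [← map_sub]; simp
    have both : fderiv ℝ κ p (1, 0) = 0 ∧ fderiv ℝ κ p (0, 1) = 0 := by
      by_cases hx : deriv X p.1 = 0
      · have hy : deriv Y p.2 ≠ 0 := by
          intro hy
          simp only [hx, hy, zero_mul, zero_add, mul_eq_zero, pz, or_false] at hE'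
          simp [hx, hy, hE'] at hpB
        have hz : deriv Z (-p.1 - p.2) ≠ 0 := by
          intro hz
          simp [hx, hz, hy, py] at hE'
        have h1 := hdy p hp hy
        have h2 := hdz p hp hz
        exact ⟨h1, by linarith⟩
      · by_cases hy : deriv Y p.2 = 0
        · have hz : deriv Z (-p.1 - p.2) ≠ 0 := by
            intro hz
            simp [hy, hz, hx, px] at hE'
          have h1 := hdx p hp hx
          have h2 := hdz p hp hz
          exact ⟨by linarith, h1⟩
        · exact ⟨hdy p hp hy, hdx p hp hx⟩
    ext
    · simpa using both.1
    · simpa using both.2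
  -- All first derivatives vanish near `p`, hence so does `X''` at `p`, and every term in the
  -- numerator of `commonRatio` is zero.
  · intro p hp hev
    have h2 : ∀ᶠ u in 𝓝 p.1, deriv X u = 0 := by
      have : ∀ᶠ q in 𝓝 p, deriv X q.1 = 0 := by
        filter_upwards [hev] with q hq
        by_contra h
        exact hq (Or.inl h)
      have hc : Filter.Tendsto (fun u : ℝ => (u, p.2)) (𝓝 p.1) (𝓝 p) :=
        (Continuous.prodMk_left p.2).tendsto p.1
      exact hc.eventually this
    have hz : deriv (deriv X) p.1 = 0 := by
      have : deriv X =ᶠ[𝓝 p.1] fun _ => 0 := h2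
      rw [this.deriv_eq]; simp
    have := hev.self_of_nhds
    simp only [Set.mem_ofPred_eq, not_or, not_not] at this
    rw [hκdef]
    simp [commonRatio, hz, this.1, this.2.1, this.2.2]

/-! ### Solutions of `X''' = a X'`. -/

section LinearODE

variable {U : Set ℝ} {X X₁ X₂ : ℝ → ℝ} {b : ℝ}

theorem exists_eqOn_const {F : ℝ → ℝ} (hU : IsOpen U) (hc : IsPreconnected U)
    (h : ∀ u ∈ U, HasDerivAt F 0 u) : ∃ c, ∀ u ∈ U, F u = c := by
  obtain ⟨c, hc⟩ := hU.exists_is_const_of_deriv_eq_zero hc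
    (fun u hu => (h u hu).differentiableAt.differentiableWithinAt) (fun u hu => (h u hu).deriv)
  exact ⟨c, hc⟩

/-- Three first integrals: `(X'' + b X') e^{-bu}`, `(X'' - b X') e^{bu}` and `b² X - X''`. On the
claimed form they equal `2b² q`, `2b² r` and `b² p`, which explains the witnesses. -/
theorem exp_form_of_ode (hU : IsOpen U) (hc : IsPreconnected U) (hb : 0 < b)
    (h₀ : ∀ u ∈ U, HasDerivAt X (X₁ u) u) (h₁ : ∀ u ∈ U, HasDerivAt X₁ (X₂ u) u)
    (h₂ : ∀ u ∈ U, HasDerivAt X₂ (b ^ 2 * X₁ u) u) :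
    ∃ p q r : ℝ, ∀ u ∈ U, X u = p + q * Real.exp (b * u) + r * Real.exp (-(b * u)) ∧
      X₁ u = b * (q * Real.exp (b * u) - r * Real.exp (-(b * u))) ∧
      X₂ u = b ^ 2 * (q * Real.exp (b * u) + r * Real.exp (-(b * u))) := by
  have hbu : ∀ u, HasDerivAt (fun u : ℝ => b * u) b u := fun u => by
    simpa using (hasDerivAt_id u).const_mul b
  obtain ⟨q, hq⟩ := exists_eqOn_const hU hc
    (F := fun u => (X₂ u + b * X₁ u) * Real.exp (-(b * u))) fun u hu => by
      refine HasDerivAt.congr_deriv (((h₂ u hu).add ((h₁ u hu).const_mul b)).mul (hbu u).neg.exp) ?_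
      simp only [Pi.add_apply, Pi.neg_apply]
      ring
  obtain ⟨r, hr⟩ := exists_eqOn_const hU hc
    (F := fun u => (X₂ u - b * X₁ u) * Real.exp (b * u)) fun u hu => by
      refine HasDerivAt.congr_deriv (((h₂ u hu).sub ((h₁ u hu).const_mul b)).mul (hbu u).exp) ?_
      simp only [Pi.sub_apply]
      ring
  obtain ⟨p, hp⟩ := exists_eqOn_const hU hc (F := fun u => b ^ 2 * X u - X₂ u) fun u hu => by
      refine HasDerivAt.congr_deriv (((h₀ u hu).const_mul (b ^ 2)).sub (h₂ u hu)) ?_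
      ring
  refine ⟨p / b ^ 2, q / (2 * b ^ 2), r / (2 * b ^ 2), fun u hu => ?_⟩
  rw [← hq u hu, ← hr u hu, ← hp u hu]
  have hexp : Real.exp (-(b * u)) * Real.exp (b * u) = 1 := by rw [← Real.exp_add]; simp
  generalize Real.exp (b * u) = e at *
  generalize Real.exp (-(b * u)) = e' at *
  refine ⟨?_, ?_, ?_⟩ <;> field_simp
  · linear_combination (-2 * X₂ u) * hexp
  · linear_combination (-2 * b * X₁ u) * hexp
  · linear_combination (-2 * X₂ u) * hexp

/-- Here the first integrals `X'' cos + b X' sin`, `X'' sin - b X' cos` and `b² X + X''` equal `-b²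
q`, `-b² r` and `b² p`. -/
theorem trig_form_of_ode (hU : IsOpen U) (hc : IsPreconnected U) (hb : 0 < b)
    (h₀ : ∀ u ∈ U, HasDerivAt X (X₁ u) u) (h₁ : ∀ u ∈ U, HasDerivAt X₁ (X₂ u) u)
    (h₂ : ∀ u ∈ U, HasDerivAt X₂ (-b ^ 2 * X₁ u) u) :
    ∃ p q r : ℝ, ∀ u ∈ U, X u = p + q * Real.cos (b * u) + r * Real.sin (b * u) ∧
      X₁ u = b * (r * Real.cos (b * u) - q * Real.sin (b * u)) ∧
      X₂ u = -b ^ 2 * (q * Real.cos (b * u) + r * Real.sin (b * u)) := by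
  have hbu : ∀ u, HasDerivAt (fun u : ℝ => b * u) b u := fun u => by
    simpa using (hasDerivAt_id u).const_mul b
  obtain ⟨q, hq⟩ := exists_eqOn_const hU hc
    (F := fun u => X₂ u * Real.cos (b * u) + b * X₁ u * Real.sin (b * u)) fun u hu => by
      refine HasDerivAt.congr_deriv (((h₂ u hu).mul (hbu u).cos).add (((h₁ u hu).const_mul b).mul (hbu u).sin)) ?_
      ring
  obtain ⟨r, hr⟩ := exists_eqOn_const hU hc
    (F := fun u => X₂ u * Real.sin (b * u) - b * X₁ u * Real.cos (b * u)) fun u hu => by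
      refine HasDerivAt.congr_deriv (((h₂ u hu).mul (hbu u).sin).sub (((h₁ u hu).const_mul b).mul (hbu u).cos)) ?_
      ring
  obtain ⟨p, hp⟩ := exists_eqOn_const hU hc (F := fun u => b ^ 2 * X u + X₂ u) fun u hu => by
      refine HasDerivAt.congr_deriv (((h₀ u hu).const_mul (b ^ 2)).add (h₂ u hu)) ?_
      ring
  refine ⟨p / b ^ 2, -q / b ^ 2, -r / b ^ 2, fun u hu => ?_⟩
  rw [← hq u hu, ← hr u hu, ← hp u hu]
  have hcs := Real.sin_sq_add_cos_sq (b * u)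
  generalize Real.cos (b * u) = c at *
  generalize Real.sin (b * u) = s at *
  refine ⟨?_, ?_, ?_⟩ <;> field_simp
  · linear_combination (X₂ u) * hcs
  · linear_combination (-b * X₁ u) * hcs
  · linear_combination (-X₂ u) * hcs

theorem quadratic_form_of_ode (hU : IsOpen U) (hc : IsPreconnected U)
    (h₀ : ∀ u ∈ U, HasDerivAt X (X₁ u) u) (h₁ : ∀ u ∈ U, HasDerivAt X₁ (X₂ u) u)
    (h₂ : ∀ u ∈ U, HasDerivAt X₂ 0 u) :
    ∃ p q r : ℝ, ∀ u ∈ U, X u = p + q * u + r * u ^ 2 ∧ X₁ u = q + 2 * r * u ∧ X₂ u = 2 * r := by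
  obtain ⟨r, hr⟩ := exists_eqOn_const hU hc h₂
  obtain ⟨q, hq⟩ := exists_eqOn_const hU hc (F := fun u => X₁ u - X₂ u * u) fun u hu => by
      refine HasDerivAt.congr_deriv ((h₁ u hu).sub ((h₂ u hu).mul (hasDerivAt_id u))) ?_
      simp
  obtain ⟨p, hp⟩ := exists_eqOn_const hU hc
    (F := fun u => X u - X₁ u * u + X₂ u / 2 * u ^ 2) fun u hu => by
      refine HasDerivAt.congr_deriv (((h₀ u hu).sub ((h₁ u hu).mul (hasDerivAt_id u))).add
        (((h₂ u hu).div_const 2).mul ((hasDerivAt_id u).pow 2))) ?_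
      simp
      ring
  refine ⟨p, q, r / 2, fun u hu => ?_⟩
  rw [← hr u hu, ← hq u hu, ← hp u hu]
  refine ⟨?_, ?_, ?_⟩ <;> ring

/-- Unique continuation for the equation `X''' = a X'`. -/
theorem deriv_eq_zero_of_ode {a : ℝ} (hU : IsOpen U) (hc : IsPreconnected U)
    (h₀ : ∀ u ∈ U, HasDerivAt X (X₁ u) u) (h₁ : ∀ u ∈ U, HasDerivAt X₁ (X₂ u) u)
    (h₂ : ∀ u ∈ U, HasDerivAt X₂ (a * X₁ u) u) {u₀ : ℝ} (hu₀ : u₀ ∈ U)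
    (z₁ : X₁ u₀ = 0) (z₂ : X₂ u₀ = 0) : ∀ u ∈ U, X₁ u = 0 := by
  intro u hu
  -- In each explicit form, the vanishing of `X'` and `X''` at a single point kills the coefficients
  -- other than `p`.
  rcases lt_trichotomy a 0 with ha | ha | ha
  · have hb : 0 < √(-a) := Real.sqrt_pos.2 (by linarith)
    have hab : a = -√(-a) ^ 2 := by rw [Real.sq_sqrt (by linarith)]; ring
    rw [hab] at h₂
    obtain ⟨p, q, r, H⟩ := trig_form_of_ode hU hc hb h₀ h₁ h₂
    generalize √(-a) = b at *
    obtain ⟨-, e₁, e₂⟩ := H u₀ hu₀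
    rw [z₁, eq_comm, mul_eq_zero, or_iff_right hb.ne'] at e₁
    rw [z₂, eq_comm, mul_eq_zero, or_iff_right (by simp [hb.ne'])] at e₂
    have hcs := Real.sin_sq_add_cos_sq (b * u₀)
    have hq : q = 0 := by
      linear_combination Real.cos (b * u₀) * e₂ - Real.sin (b * u₀) * e₁ - q * hcs
    have hr : r = 0 := by
      linear_combination Real.sin (b * u₀) * e₂ + Real.cos (b * u₀) * e₁ - r * hcs
    rw [(H u hu).2.1, hq, hr]
    ring
  · obtain ⟨p, q, r, H⟩ := quadratic_form_of_ode hU hc h₀ h₁ (by simpa [ha] using h₂)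
    obtain ⟨-, e₁, e₂⟩ := H u₀ hu₀
    rw [z₁] at e₁
    rw [z₂] at e₂
    rw [(H u hu).2.1]
    linear_combination -e₁ + (u₀ - u) * e₂
  · have hb : 0 < √a := Real.sqrt_pos.2 ha
    have hab : a = √a ^ 2 := by rw [Real.sq_sqrt ha.le]
    rw [hab] at h₂
    obtain ⟨p, q, r, H⟩ := exp_form_of_ode hU hc hb h₀ h₁ h₂
    generalize √a = b at *
    obtain ⟨-, e₁, e₂⟩ := H u₀ hu₀
    rw [z₁, eq_comm, mul_eq_zero, or_iff_right hb.ne'] at e₁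
    rw [z₂, eq_comm, mul_eq_zero, or_iff_right (by simp [hb.ne'])] at e₂
    have hq : q = 0 := by
      have : q * Real.exp (b * u₀) = 0 := by linarith
      simpa using this
    have hr : r = 0 := by
      have : r * Real.exp (-(b * u₀)) = 0 := by linarith
      simpa using this
    rw [(H u hu).2.1, hq, hr]
    ring

end LinearODE

/-! ### Conditions on the coefficients. -/

theorem IsOpen.exists_ne_mem {U : Set ℝ} (hU : IsOpen U) {u : ℝ} (hu : u ∈ U) :
    ∃ u' ∈ U, u' ≠ u := by
  obtain ⟨ε, hε, h⟩ := Metric.isOpen_iff.1 hU u hu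
  exact ⟨u + ε / 2, h (by simp [abs_of_pos hε]; linarith), by simp [hε.ne']⟩

/-- Linear independence of `exp (b u)` and `exp (-b u)` on an open set. -/
theorem exp_coeffs_eq_zero {U : Set ℝ} (hU : IsOpen U) (hne : U.Nonempty) {b c d : ℝ}
    (hb : 0 < b) (h : ∀ u ∈ U, c * Real.exp (b * u) + d * Real.exp (-(b * u)) = 0) :
    c = 0 ∧ d = 0 := by
  obtain ⟨u, hu⟩ := hne
  have hbu : HasDerivAt (fun u : ℝ => b * u) b u := by
    simpa using (hasDerivAt_id u).const_mul b
  have h0 : (fun u => c * Real.exp (b * u) + d * Real.exp (-(b * u))) =ᶠ[𝓝 u] fun _ => 0 := by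
    filter_upwards [hU.mem_nhds hu] with t ht using h t ht
  -- The identity and its derivative at one point form an invertible system for `c` and `d`.
  have e₁ := ((hbu.exp.const_mul c).add (hbu.neg.exp.const_mul d)).unique
    ((hasDerivAt_const u (0 : ℝ)).congr_of_eventuallyEq h0)
  have e₀ := h u hu
  have e₂ : c * Real.exp (b * u) - d * Real.exp (-(b * u)) = 0 := by
    apply mul_left_cancel₀ hb.ne'
    linear_combination e₁
  constructor
  · have : c * Real.exp (b * u) = 0 := by linarith
    simpa using this
  · have : d * Real.exp (-(b * u)) = 0 := by linarith
    simpa using this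

/-- Linear independence of `cos (b u)` and `sin (b u)` on an open set. -/
theorem trig_coeffs_eq_zero {U : Set ℝ} (hU : IsOpen U) (hne : U.Nonempty) {b c d : ℝ}
    (hb : 0 < b) (h : ∀ u ∈ U, c * Real.cos (b * u) + d * Real.sin (b * u) = 0) :
    c = 0 ∧ d = 0 := by
  obtain ⟨u, hu⟩ := hne
  have hbu : HasDerivAt (fun u : ℝ => b * u) b u := by
    simpa using (hasDerivAt_id u).const_mul b
  have h0 : (fun u => c * Real.cos (b * u) + d * Real.sin (b * u)) =ᶠ[𝓝 u] fun _ => 0 := by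
    filter_upwards [hU.mem_nhds hu] with t ht using h t ht
  have e₁ := ((hbu.cos.const_mul c).add (hbu.sin.const_mul d)).unique
    ((hasDerivAt_const u (0 : ℝ)).congr_of_eventuallyEq h0)
  have e₀ := h u hu
  have e₂ : d * Real.cos (b * u) - c * Real.sin (b * u) = 0 := by
    apply mul_left_cancel₀ hb.ne'
    linear_combination e₁
  have hcs := Real.sin_sq_add_cos_sq (b * u)
  constructor
  · linear_combination Real.cos (b * u) * e₀ - Real.sin (b * u) * e₂ - c * hcs
  · linear_combination Real.sin (b * u) * e₀ + Real.cos (b * u) * e₂ - d * hcs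

/-- The relation `X''' (Y + Z) = Y'' (X' - Z') + Z'' (X' - Y')` for combinations of
exponentials. -/
theorem exp_coeffs_of_relation {U : Set ℝ} (hU : IsOpen U) (hne : U.Nonempty) {b : ℝ} (hb : 0 < b)
    {p₂ p₃ q₁ q₂ q₃ r₁ r₂ r₃ : ℝ}
    (h : ∀ u ∈ U, ∃ v w x₁ y₀ y₁ y₂ z₀ z₁ z₂ : ℝ, u + v + w = 0 ∧
      x₁ = b * (q₁ * Real.exp (b * u) - r₁ * Real.exp (-(b * u))) ∧
      y₀ = p₂ + q₂ * Real.exp (b * v) + r₂ * Real.exp (-(b * v)) ∧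
      y₁ = b * (q₂ * Real.exp (b * v) - r₂ * Real.exp (-(b * v))) ∧
      y₂ = b ^ 2 * (q₂ * Real.exp (b * v) + r₂ * Real.exp (-(b * v))) ∧
      z₀ = p₃ + q₃ * Real.exp (b * w) + r₃ * Real.exp (-(b * w)) ∧
      z₁ = b * (q₃ * Real.exp (b * w) - r₃ * Real.exp (-(b * w))) ∧
      z₂ = b ^ 2 * (q₃ * Real.exp (b * w) + r₃ * Real.exp (-(b * w))) ∧
      b ^ 2 * x₁ * (y₀ + z₀) = y₂ * (x₁ - z₁) + z₂ * (x₁ - y₁)) :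
    (p₂ + p₃) * r₁ - 2 * q₂ * q₃ = 0 ∧ (p₂ + p₃) * q₁ - 2 * r₂ * r₃ = 0 := by
  -- Since `Y'' = b² (Y - p₂)` and `Z'' = b² (Z - p₃)`, the relation collapses to `b² (p₂ + p₃) X' =
  -- -(Y'' Z' + Z'' Y')`. The mixed products cancel on the right, and `v + w = -u` turns the others
  -- into `e^{bu}` and `e^{-bu}`.
  have key := exp_coeffs_eq_zero hU hne hb (c := (p₂ + p₃) * q₁ - 2 * r₂ * r₃)
    (d := -((p₂ + p₃) * r₁ - 2 * q₂ * q₃)) fun u hu => by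
      obtain ⟨v, w, x₁, y₀, y₁, y₂, z₀, z₁, z₂, hs, rfl, rfl, rfl, rfl, rfl, rfl, rfl, H⟩ := h u hu
      have e₁ : Real.exp (-(b * u)) = Real.exp (b * v) * Real.exp (b * w) := by
        rw [← Real.exp_add]; congr 1; linear_combination (-b) * hs
      have e₂ : Real.exp (b * u) = Real.exp (-(b * v)) * Real.exp (-(b * w)) := by
        rw [← Real.exp_add]; congr 1; linear_combination b * hs
      apply mul_left_cancel₀ (pow_ne_zero 3 hb.ne')
      linear_combination H - 2 * b ^ 3 * r₂ * r₃ * e₂ + 2 * b ^ 3 * q₂ * q₃ * e₁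
  exact ⟨neg_eq_zero.1 key.2, key.1⟩

/-- The relation `X''' (Y + Z) = Y'' (X' - Z') + Z'' (X' - Y')` for combinations of
trigonometric functions. -/
theorem trig_coeffs_of_relation {U : Set ℝ} (hU : IsOpen U) (hne : U.Nonempty) {b : ℝ} (hb : 0 < b)
    {p₂ p₃ q₁ q₂ q₃ r₁ r₂ r₃ : ℝ}
    (h : ∀ u ∈ U, ∃ v w x₁ y₀ y₁ y₂ z₀ z₁ z₂ : ℝ, u + v + w = 0 ∧
      x₁ = b * (r₁ * Real.cos (b * u) - q₁ * Real.sin (b * u)) ∧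
      y₀ = p₂ + q₂ * Real.cos (b * v) + r₂ * Real.sin (b * v) ∧
      y₁ = b * (r₂ * Real.cos (b * v) - q₂ * Real.sin (b * v)) ∧
      y₂ = -b ^ 2 * (q₂ * Real.cos (b * v) + r₂ * Real.sin (b * v)) ∧
      z₀ = p₃ + q₃ * Real.cos (b * w) + r₃ * Real.sin (b * w) ∧
      z₁ = b * (r₃ * Real.cos (b * w) - q₃ * Real.sin (b * w)) ∧
      z₂ = -b ^ 2 * (q₃ * Real.cos (b * w) + r₃ * Real.sin (b * w)) ∧
      -b ^ 2 * x₁ * (y₀ + z₀) = y₂ * (x₁ - z₁) + z₂ * (x₁ - y₁)) :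
    (p₂ + p₃) * q₁ - q₂ * q₃ + r₂ * r₃ = 0 ∧ (p₂ + p₃) * r₁ + q₂ * r₃ + q₃ * r₂ = 0 := by
  -- The same collapse with `-b²` in place of `b²`; the addition formulas rewrite the right side in
  -- `cos (b u)` and `sin (b u)`.
  have key := trig_coeffs_eq_zero hU hne hb (c := (p₂ + p₃) * r₁ + q₂ * r₃ + q₃ * r₂)
    (d := -((p₂ + p₃) * q₁ - q₂ * q₃ + r₂ * r₃)) fun u hu => by
      obtain ⟨v, w, x₁, y₀, y₁, y₂, z₀, z₁, z₂, hs, rfl, rfl, rfl, rfl, rfl, rfl, rfl, H⟩ := h u hu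
      have e₁ : Real.cos (b * u) = Real.cos (b * v) * Real.cos (b * w) -
          Real.sin (b * v) * Real.sin (b * w) := by
        rw [← Real.cos_add, ← Real.cos_neg]; congr 1; linear_combination (-b) * hs
      have e₂ : Real.sin (b * u) = -(Real.sin (b * v) * Real.cos (b * w) +
          Real.cos (b * v) * Real.sin (b * w)) := by
        rw [← Real.sin_add, ← Real.sin_neg]; congr 1; linear_combination b * hs
      apply mul_left_cancel₀ (pow_ne_zero 3 hb.ne')
      linear_combination -H + b ^ 3 * (q₂ * r₃ + q₃ * r₂) * e₁ + b ^ 3 * (q₂ * q₃ - r₂ * r₃) * e₂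
  exact ⟨neg_eq_zero.1 key.2, key.1⟩

/-- The relations are polynomials in `u`, `v`. Once the quadratic form in the `rᵢ` is known to
vanish, the values at one point determine the other coefficient conditions, taken in descending
degree. -/
theorem quadratic_coeffs_of_relations {p₁ p₂ p₃ q₁ q₂ q₃ r₁ r₂ r₃ u v w u' v' w' : ℝ}
    (hs : u + v + w = 0) (hs' : u' + v' + w' = 0) (hne : u' ≠ u)
    (hE : (q₁ + 2 * r₁ * u) * ((p₂ + q₂ * v + r₂ * v ^ 2) + (p₃ + q₃ * w + r₃ * w ^ 2)) +
      (q₂ + 2 * r₂ * v) * ((p₁ + q₁ * u + r₁ * u ^ 2) + (p₃ + q₃ * w + r₃ * w ^ 2)) +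
      (q₃ + 2 * r₃ * w) * ((p₁ + q₁ * u + r₁ * u ^ 2) + (p₂ + q₂ * v + r₂ * v ^ 2)) = 0)
    (hF₁ : 2 * r₁ * ((p₂ + q₂ * v + r₂ * v ^ 2) + (p₃ + q₃ * w + r₃ * w ^ 2)) -
      2 * r₂ * ((p₁ + q₁ * u + r₁ * u ^ 2) + (p₃ + q₃ * w + r₃ * w ^ 2)) +
      (q₃ + 2 * r₃ * w) * ((q₁ + 2 * r₁ * u) - (q₂ + 2 * r₂ * v)) = 0)
    (hF₂ : 2 * r₂ * ((p₁ + q₁ * u + r₁ * u ^ 2) + (p₃ + q₃ * w + r₃ * w ^ 2)) -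
      2 * r₃ * ((p₁ + q₁ * u + r₁ * u ^ 2) + (p₂ + q₂ * v + r₂ * v ^ 2)) +
      (q₁ + 2 * r₁ * u) * ((q₂ + 2 * r₂ * v) - (q₃ + 2 * r₃ * w)) = 0)
    (hG₁ : 0 = 2 * r₂ * ((q₁ + 2 * r₁ * u) - (q₃ + 2 * r₃ * w)) +
      2 * r₃ * ((q₁ + 2 * r₁ * u) - (q₂ + 2 * r₂ * v)))
    (hG₁' : 0 = 2 * r₂ * ((q₁ + 2 * r₁ * u') - (q₃ + 2 * r₃ * w')) +
      2 * r₃ * ((q₁ + 2 * r₁ * u') - (q₂ + 2 * r₂ * v')))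
    (hG₂ : 0 = 2 * r₁ * ((q₂ + 2 * r₂ * v) - (q₃ + 2 * r₃ * w)) +
      2 * r₃ * ((q₂ + 2 * r₂ * v) - (q₁ + 2 * r₁ * u))) :
    QuadCoeffs ![p₁, p₂, p₃] ![q₁, q₂, q₃] ![r₁, r₂, r₃] := by
  obtain rfl : w = -u - v := by linarith
  obtain rfl : w' = -u' - v' := by linarith
  -- As a polynomial, the right side of `hG₁` is affine in `u` with slope four times this
  -- expression, so two points with different `u` suffice.
  have hS : r₁ * r₂ + r₁ * r₃ + r₂ * r₃ = 0 := by
    apply mul_left_cancel₀ (sub_ne_zero.2 hne)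
    linear_combination (hG₁ - hG₁') / 4
  have D₁ : r₂ * (q₁ - q₃) + r₃ * (q₁ - q₂) = 0 := by
    linear_combination -hG₁ / 2 - 2 * u * hS
  have D₂ : r₁ * (q₂ - q₃) + r₃ * (q₂ - q₁) = 0 := by
    linear_combination -hG₂ / 2 - 2 * v * hS
  have C₂ : 2 * (p₂ + p₃) * r₁ - 2 * (p₁ + p₂) * r₃ + q₂ * (q₁ - q₃) = 0 := by
    linear_combination hF₁ + hF₂ - 2 * u * D₂ - 2 * v * (D₁ + D₂) - (2 * v ^ 2 + 4 * u * v) * hS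
  have C₃ : 2 * (p₁ + p₃) * r₂ - 2 * (p₁ + p₂) * r₃ + q₁ * (q₂ - q₃) = 0 := by
    linear_combination hF₂ - 2 * v * D₁ - 2 * u * (D₁ + D₂) - (2 * u ^ 2 + 4 * u * v) * hS
  refine ⟨?_, ?_, ?_, ?_, ?_, ?_⟩ <;> simp
  · linear_combination hE - u * C₂ - v * C₃ - u ^ 2 * D₂ - v ^ 2 * D₁ - 2 * u * v * (D₁ + D₂) +
      2 * u * v * (-u - v) * hS
  · linear_combination C₂
  · linear_combination C₃
  · linear_combination D₂
  · linear_combination D₁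
  · linear_combination hS

/-! ### Classification of the solutions of the functional equation. -/

theorem isOpenMap_neg_sub : IsOpenMap fun p : ℝ × ℝ => -p.1 - p.2 :=
  (-ContinuousLinearMap.fst ℝ ℝ ℝ - ContinuousLinearMap.snd ℝ ℝ ℝ).isOpenMap
    fun w => ⟨(-w, 0), by simp⟩

/-- Classification of the positive smooth solutions of the functional equation
`X' (Y + Z) + Y' (X + Z) + Z' (X + Y) = 0` on an open part of the plane `u + v + w = 0`. -/
theorem functional_equation_solutions {Ω : Set (ℝ × ℝ)} (hΩ : IsOpen Ω) (hc : IsConnected Ω)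
    {X Y Z : ℝ → ℝ} (hX : ∀ p ∈ Ω, ContDiffAt ℝ ∞ X p.1) (hY : ∀ p ∈ Ω, ContDiffAt ℝ ∞ Y p.2)
    (hZ : ∀ p ∈ Ω, ContDiffAt ℝ ∞ Z (-p.1 - p.2))
    (hX0 : ∀ p ∈ Ω, 0 < X p.1) (hY0 : ∀ p ∈ Ω, 0 < Y p.2) (hZ0 : ∀ p ∈ Ω, 0 < Z (-p.1 - p.2))
    (hE : ∀ p ∈ Ω, deriv X p.1 * (Y p.2 + Z (-p.1 - p.2)) +
      deriv Y p.2 * (X p.1 + Z (-p.1 - p.2)) + deriv Z (-p.1 - p.2) * (X p.1 + Y p.2) = 0)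
    (hXn : ∃ p ∈ Ω, deriv X p.1 ≠ 0) (hYn : ∃ p ∈ Ω, deriv Y p.2 ≠ 0)
    (hZn : ∃ p ∈ Ω, deriv Z (-p.1 - p.2) ≠ 0) :
    (∃ p ∈ Ω, deriv X p.1 ≠ 0 ∧ deriv Y p.2 ≠ 0 ∧ deriv Z (-p.1 - p.2) ≠ 0) ∧
    ∃ a : ℝ, (∀ p ∈ Ω, deriv (deriv (deriv X)) p.1 = a * deriv X p.1 ∧
      deriv (deriv (deriv Y)) p.2 = a * deriv Y p.2 ∧
      deriv (deriv (deriv Z)) (-p.1 - p.2) = a * deriv Z (-p.1 - p.2)) ∧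
    (0 < a → ∃ b : ℝ, 0 < b ∧ a = b ^ 2 ∧ ∃ p q r : Fin 3 → ℝ, ExpCoeffs p q r ∧ ∀ t ∈ Ω,
      X t.1 = p 0 + q 0 * Real.exp (b * t.1) + r 0 * Real.exp (-(b * t.1)) ∧
      Y t.2 = p 1 + q 1 * Real.exp (b * t.2) + r 1 * Real.exp (-(b * t.2)) ∧
      Z (-t.1 - t.2) = p 2 + q 2 * Real.exp (b * (-t.1 - t.2)) +
        r 2 * Real.exp (-(b * (-t.1 - t.2)))) ∧
    (a < 0 → ∃ b : ℝ, 0 < b ∧ a = -b ^ 2 ∧ ∃ p q r : Fin 3 → ℝ, TrigCoeffs p q r ∧ ∀ t ∈ Ω,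
      X t.1 = p 0 + q 0 * Real.cos (b * t.1) + r 0 * Real.sin (b * t.1) ∧
      Y t.2 = p 1 + q 1 * Real.cos (b * t.2) + r 1 * Real.sin (b * t.2) ∧
      Z (-t.1 - t.2) = p 2 + q 2 * Real.cos (b * (-t.1 - t.2)) +
        r 2 * Real.sin (b * (-t.1 - t.2))) ∧
    (a = 0 → ∃ p q r : Fin 3 → ℝ, QuadCoeffs p q r ∧ ∀ t ∈ Ω,
      X t.1 = p 0 + q 0 * t.1 + r 0 * t.1 ^ 2 ∧ Y t.2 = p 1 + q 1 * t.2 + r 1 * t.2 ^ 2 ∧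
      Z (-t.1 - t.2) = p 2 + q 2 * (-t.1 - t.2) + r 2 * (-t.1 - t.2) ^ 2) := by
  have dX0 := fun p hp => (hX p hp).hasDerivAt_of_infty
  have dX1 := fun p hp => (hX p hp).deriv_of_infty.hasDerivAt_of_infty
  have dX2 := fun p hp => (hX p hp).deriv_of_infty.deriv_of_infty.hasDerivAt_of_infty
  have dY0 := fun p hp => (hY p hp).hasDerivAt_of_infty
  have dY1 := fun p hp => (hY p hp).deriv_of_infty.hasDerivAt_of_infty
  have dY2 := fun p hp => (hY p hp).deriv_of_infty.deriv_of_infty.hasDerivAt_of_infty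
  have dZ0 := fun p hp => (hZ p hp).hasDerivAt_of_infty
  have dZ1 := fun p hp => (hZ p hp).deriv_of_infty.hasDerivAt_of_infty
  have dZ2 := fun p hp => (hZ p hp).deriv_of_infty.deriv_of_infty.hasDerivAt_of_infty
  have hF := second_deriv_relations hΩ dX0 dX1 dY0 dY1 dZ0 dZ1 hE
  have hG := third_deriv_relations hΩ dX0 dX1 dX2 dY0 dY1 dY2 dZ0 dZ1 dZ2 hE
  obtain ⟨a, ha⟩ := exists_common_ratio hΩ hc.isPreconnected hX hY hZ hX0 hY0 hZ0 hE
  obtain ⟨U, hUdef⟩ : ∃ U : Set ℝ, U = Prod.fst '' Ω := ⟨_, rfl⟩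
  obtain ⟨V, hVdef⟩ : ∃ V : Set ℝ, V = Prod.snd '' Ω := ⟨_, rfl⟩
  obtain ⟨W, hWdef⟩ : ∃ W : Set ℝ, W = (fun p : ℝ × ℝ => -p.1 - p.2) '' Ω := ⟨_, rfl⟩
  have oU : IsOpen U := hUdef ▸ isOpenMap_fst _ hΩ
  have oV : IsOpen V := hVdef ▸ isOpenMap_snd _ hΩ
  have oW : IsOpen W := hWdef ▸ isOpenMap_neg_sub _ hΩ
  have cU : IsConnected U := hUdef ▸ hc.image _ continuous_fst.continuousOn
  have cV : IsConnected V := hVdef ▸ hc.image _ continuous_snd.continuousOn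
  have cW : IsConnected W := hWdef ▸ hc.image _ (by fun_prop)
  have mU : ∀ p ∈ Ω, p.1 ∈ U := fun p hp => hUdef ▸ ⟨p, hp, rfl⟩
  have mV : ∀ p ∈ Ω, p.2 ∈ V := fun p hp => hVdef ▸ ⟨p, hp, rfl⟩
  have mW : ∀ p ∈ Ω, -p.1 - p.2 ∈ W := fun p hp => hWdef ▸ ⟨p, hp, rfl⟩
  have fU : ∀ {P : ℝ → Prop}, (∀ p ∈ Ω, P p.1) → ∀ u ∈ U, P u := by
    intro P hP u hu; rw [hUdef] at hu; obtain ⟨p, hp, rfl⟩ := hu; exact hP p hp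
  have fV : ∀ {P : ℝ → Prop}, (∀ p ∈ Ω, P p.2) → ∀ u ∈ V, P u := by
    intro P hP u hu; rw [hVdef] at hu; obtain ⟨p, hp, rfl⟩ := hu; exact hP p hp
  have fW : ∀ {P : ℝ → Prop}, (∀ p ∈ Ω, P (-p.1 - p.2)) → ∀ u ∈ W, P u := by
    intro P hP u hu; rw [hWdef] at hu; obtain ⟨p, hp, rfl⟩ := hu; exact hP p hp
  have DX0 := fU (P := fun u => HasDerivAt X (deriv X u) u) dX0
  have DX1 := fU (P := fun u => HasDerivAt (deriv X) (deriv (deriv X) u) u) dX1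
  have DX2 := fU (P := fun u => HasDerivAt (deriv (deriv X)) (a * deriv X u) u)
    fun p hp => (ha p hp).1 ▸ dX2 p hp
  have DY0 := fV (P := fun u => HasDerivAt Y (deriv Y u) u) dY0
  have DY1 := fV (P := fun u => HasDerivAt (deriv Y) (deriv (deriv Y) u) u) dY1
  have DY2 := fV (P := fun u => HasDerivAt (deriv (deriv Y)) (a * deriv Y u) u)
    fun p hp => (ha p hp).2.1 ▸ dY2 p hp
  have DZ0 := fW (P := fun u => HasDerivAt Z (deriv Z u) u) dZ0
  have DZ1 := fW (P := fun u => HasDerivAt (deriv Z) (deriv (deriv Z) u) u) dZ1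
  have DZ2 := fW (P := fun u => HasDerivAt (deriv (deriv Z)) (a * deriv Z u) u)
    fun p hp => (ha p hp).2.2 ▸ dZ2 p hp
  refine ⟨?_, a, ha, fun ha0 => ?_, fun ha0 => ?_, fun ha0 => ?_⟩
  · obtain ⟨p, hp, hxp⟩ := hXn
    have o₁ : IsOpen (Ω ∩ (fun q : ℝ × ℝ => deriv X q.1) ⁻¹' {0}ᶜ) := by
      refine ContinuousOn.isOpen_inter_preimage (fun q hq => ?_) hΩ isOpen_compl_singleton
      exact (dX1 q hq).comp_fst_hasFDerivAt.continuousAt.continuousWithinAt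
    -- If `Y'` vanished throughout the open set `X' ≠ 0`, then `Y' = Y'' = 0` at one point and
    -- unique continuation would give `Y' = 0` everywhere. The argument is repeated for `Z'` on the
    -- smaller open set.
    obtain ⟨q, ⟨hq, hxq⟩, hyq⟩ : ∃ q ∈ Ω ∩ (fun q : ℝ × ℝ => deriv X q.1) ⁻¹' {0}ᶜ,
        deriv Y q.2 ≠ 0 := by
      by_contra! hcon
      have h2 := (dY1 p hp).comp_snd_hasFDerivAt.eq_zero_of_eqOn_zero o₁ hcon ⟨hp, hxp⟩
      have h2 := congrArg (fun L : ℝ × ℝ →L[ℝ] ℝ => L (0, 1)) h2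
      obtain ⟨p', hp', hyp'⟩ := hYn
      exact hyp' (deriv_eq_zero_of_ode oV cV.isPreconnected DY0 DY1 DY2 (mV p hp)
        (hcon p ⟨hp, hxp⟩) (by simpa using h2) _ (mV p' hp'))
    have o₂ : IsOpen ((Ω ∩ (fun q : ℝ × ℝ => deriv X q.1) ⁻¹' {0}ᶜ) ∩
        (fun q : ℝ × ℝ => deriv Y q.2) ⁻¹' {0}ᶜ) := by
      refine ContinuousOn.isOpen_inter_preimage (fun q hq => ?_) o₁ isOpen_compl_singleton
      exact (dY1 q hq.1).comp_snd_hasFDerivAt.continuousAt.continuousWithinAt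
    by_contra! hcon
    have h1 : ∀ t ∈ (Ω ∩ (fun q : ℝ × ℝ => deriv X q.1) ⁻¹' {0}ᶜ) ∩
        (fun q : ℝ × ℝ => deriv Y q.2) ⁻¹' {0}ᶜ, deriv Z (-t.1 - t.2) = 0 :=
      fun t ht => hcon t ht.1.1 ht.1.2 ht.2
    have h2 := (dZ1 q hq).comp_neg_sub_hasFDerivAt.eq_zero_of_eqOn_zero o₂ h1 ⟨⟨hq, hxq⟩, hyq⟩
    have h2 := congrArg (fun L : ℝ × ℝ →L[ℝ] ℝ => L (0, 1)) h2
    obtain ⟨p', hp', hzp'⟩ := hZn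
    exact hzp' (deriv_eq_zero_of_ode oW cW.isPreconnected DZ0 DZ1 DZ2 (mW q hq)
      (h1 q ⟨⟨hq, hxq⟩, hyq⟩) (by simpa using h2) _ (mW p' hp'))
  · have hb : 0 < √a := Real.sqrt_pos.2 ha0
    have hab : a = √a ^ 2 := (Real.sq_sqrt ha0.le).symm
    generalize √a = b at *
    subst hab
    obtain ⟨p₁, q₁, r₁, HX⟩ := exp_form_of_ode oU cU.isPreconnected hb DX0 DX1 DX2
    obtain ⟨p₂, q₂, r₂, HY⟩ := exp_form_of_ode oV cV.isPreconnected hb DY0 DY1 DY2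
    obtain ⟨p₃, q₃, r₃, HZ⟩ := exp_form_of_ode oW cW.isPreconnected hb DZ0 DZ1 DZ2
    refine ⟨b, hb, rfl, ![p₁, p₂, p₃], ![q₁, q₂, q₃], ![r₁, r₂, r₃], ?_, fun t ht =>
      ⟨(HX _ (mU t ht)).1, (HY _ (mV t ht)).1, (HZ _ (mW t ht)).1⟩⟩
    -- The third-order relations are permuted among themselves by exchanging the functions, so one
    -- lemma serves all three.
    have R₁ := exp_coeffs_of_relation oU cU.nonempty hb (p₂ := p₂) (p₃ := p₃) (q₁ := q₁)
      (r₁ := r₁) (q₂ := q₂) (q₃ := q₃) (r₂ := r₂) (r₃ := r₃) (fU fun t ht =>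
        ⟨t.2, -t.1 - t.2, _, _, _, _, _, _, _, by ring, (HX _ (mU t ht)).2.1, (HY _ (mV t ht)).1,
          (HY _ (mV t ht)).2.1, (HY _ (mV t ht)).2.2, (HZ _ (mW t ht)).1,
          (HZ _ (mW t ht)).2.1, (HZ _ (mW t ht)).2.2, by rw [← (ha t ht).1]; exact (hG t ht).1⟩)
    have R₂ := exp_coeffs_of_relation oV cV.nonempty hb (p₂ := p₁) (p₃ := p₃) (q₁ := q₂)
      (r₁ := r₂) (q₂ := q₁) (q₃ := q₃) (r₂ := r₁) (r₃ := r₃) (fV fun t ht =>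
        ⟨t.1, -t.1 - t.2, _, _, _, _, _, _, _, by ring, (HY _ (mV t ht)).2.1, (HX _ (mU t ht)).1,
          (HX _ (mU t ht)).2.1, (HX _ (mU t ht)).2.2, (HZ _ (mW t ht)).1,
          (HZ _ (mW t ht)).2.1, (HZ _ (mW t ht)).2.2, by
            rw [← (ha t ht).2.1]; exact (hG t ht).2.1⟩)
    have R₃ := exp_coeffs_of_relation oW cW.nonempty hb (p₂ := p₁) (p₃ := p₂) (q₁ := q₃)
      (r₁ := r₃) (q₂ := q₁) (q₃ := q₂) (r₂ := r₁) (r₃ := r₂) (fW fun t ht =>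
        ⟨t.1, t.2, _, _, _, _, _, _, _, by ring, (HZ _ (mW t ht)).2.1, (HX _ (mU t ht)).1,
          (HX _ (mU t ht)).2.1, (HX _ (mU t ht)).2.2, (HY _ (mV t ht)).1,
          (HY _ (mV t ht)).2.1, (HY _ (mV t ht)).2.2, by
            rw [← (ha t ht).2.2]; exact (hG t ht).2.2⟩)
    exact ⟨R₁.1, R₂.1, R₁.2, R₂.2, R₃.2, R₃.1⟩
  · have hb : 0 < √(-a) := Real.sqrt_pos.2 (by linarith)
    have hab : a = -√(-a) ^ 2 := by rw [Real.sq_sqrt (by linarith)]; ring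
    generalize √(-a) = b at *
    subst hab
    obtain ⟨p₁, q₁, r₁, HX⟩ := trig_form_of_ode oU cU.isPreconnected hb DX0 DX1 DX2
    obtain ⟨p₂, q₂, r₂, HY⟩ := trig_form_of_ode oV cV.isPreconnected hb DY0 DY1 DY2
    obtain ⟨p₃, q₃, r₃, HZ⟩ := trig_form_of_ode oW cW.isPreconnected hb DZ0 DZ1 DZ2
    refine ⟨b, hb, rfl, ![p₁, p₂, p₃], ![q₁, q₂, q₃], ![r₁, r₂, r₃], ?_, fun t ht =>
      ⟨(HX _ (mU t ht)).1, (HY _ (mV t ht)).1, (HZ _ (mW t ht)).1⟩⟩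
    have R₁ := trig_coeffs_of_relation oU cU.nonempty hb (p₂ := p₂) (p₃ := p₃) (q₁ := q₁)
      (r₁ := r₁) (q₂ := q₂) (q₃ := q₃) (r₂ := r₂) (r₃ := r₃) (fU fun t ht =>
        ⟨t.2, -t.1 - t.2, _, _, _, _, _, _, _, by ring, (HX _ (mU t ht)).2.1, (HY _ (mV t ht)).1,
          (HY _ (mV t ht)).2.1, (HY _ (mV t ht)).2.2, (HZ _ (mW t ht)).1,
          (HZ _ (mW t ht)).2.1, (HZ _ (mW t ht)).2.2, by rw [← (ha t ht).1]; exact (hG t ht).1⟩)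
    have R₂ := trig_coeffs_of_relation oV cV.nonempty hb (p₂ := p₁) (p₃ := p₃) (q₁ := q₂)
      (r₁ := r₂) (q₂ := q₁) (q₃ := q₃) (r₂ := r₁) (r₃ := r₃) (fV fun t ht =>
        ⟨t.1, -t.1 - t.2, _, _, _, _, _, _, _, by ring, (HY _ (mV t ht)).2.1, (HX _ (mU t ht)).1,
          (HX _ (mU t ht)).2.1, (HX _ (mU t ht)).2.2, (HZ _ (mW t ht)).1,
          (HZ _ (mW t ht)).2.1, (HZ _ (mW t ht)).2.2, by
            rw [← (ha t ht).2.1]; exact (hG t ht).2.1⟩)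
    have R₃ := trig_coeffs_of_relation oW cW.nonempty hb (p₂ := p₁) (p₃ := p₂) (q₁ := q₃)
      (r₁ := r₃) (q₂ := q₁) (q₃ := q₂) (r₂ := r₁) (r₃ := r₂) (fW fun t ht =>
        ⟨t.1, t.2, _, _, _, _, _, _, _, by ring, (HZ _ (mW t ht)).2.1, (HX _ (mU t ht)).1,
          (HX _ (mU t ht)).2.1, (HX _ (mU t ht)).2.2, (HY _ (mV t ht)).1,
          (HY _ (mV t ht)).2.1, (HY _ (mV t ht)).2.2, by
            rw [← (ha t ht).2.2]; exact (hG t ht).2.2⟩)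
    exact ⟨R₁.1, R₁.2, R₂.1, R₂.2, R₃.1, R₃.2⟩
  · simp only [ha0, zero_mul] at DX2 DY2 DZ2 ha
    obtain ⟨p₁, q₁, r₁, HX⟩ := quadratic_form_of_ode oU cU.isPreconnected DX0 DX1 DX2
    obtain ⟨p₂, q₂, r₂, HY⟩ := quadratic_form_of_ode oV cV.isPreconnected DY0 DY1 DY2
    obtain ⟨p₃, q₃, r₃, HZ⟩ := quadratic_form_of_ode oW cW.isPreconnected DZ0 DZ1 DZ2
    refine ⟨![p₁, p₂, p₃], ![q₁, q₂, q₃], ![r₁, r₂, r₃], ?_, fun t ht =>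
      ⟨(HX _ (mU t ht)).1, (HY _ (mV t ht)).1, (HZ _ (mW t ht)).1⟩⟩
    obtain ⟨t, ht⟩ := hc.nonempty
    -- A second point with another value of `u`, as needed for the slope comparison.
    obtain ⟨u', hu', hne⟩ := oU.exists_ne_mem (mU t ht)
    rw [hUdef] at hu'
    obtain ⟨t', ht', rfl⟩ := hu'
    have e := hE t ht
    have f := hF t ht
    have g := hG t ht
    have g' := (hG t' ht').1
    obtain ⟨x₀, x₁, x₂⟩ := HX _ (mU t ht)
    obtain ⟨y₀, y₁, y₂⟩ := HY _ (mV t ht)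
    obtain ⟨z₀, z₁, z₂⟩ := HZ _ (mW t ht)
    obtain ⟨x₀', x₁', x₂'⟩ := HX _ (mU t' ht')
    obtain ⟨y₀', y₁', y₂'⟩ := HY _ (mV t' ht')
    obtain ⟨z₀', z₁', z₂'⟩ := HZ _ (mW t' ht')
    rw [(ha t ht).1, (ha t ht).2.1, (ha t ht).2.2] at g
    rw [(ha t' ht').1] at g'
    rw [x₀, x₁, y₀, y₁, z₀, z₁] at e
    rw [x₀, x₁, x₂, y₀, y₁, y₂, z₀, z₁, z₂] at f
    rw [x₁, x₂, y₁, y₂, z₁, z₂] at g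
    rw [x₁', y₁', y₂', z₁', z₂'] at g'
    exact quadratic_coeffs_of_relations (v' := t'.2) (w' := -t'.1 - t'.2) (by ring) (by ring)
      hne e f.1 f.2
      (by linarith [g.1]) (by linarith) (by linarith [g.2.1])

/-! ### Tangent planes of level sets and the trace condition. -/

section TangentPlane

variable {E : Type*} [NormedAddCommGroup E] [NormedSpace ℝ E]

/-- The tangent plane of a regular level set is the kernel of the differential. -/
theorem tangentPlane_eq_ker [CompleteSpace E] {F : E → ℝ} {F' : E →L[ℝ] ℝ} {p : E} {M : Set E}
    (hF : HasStrictFDerivAt F F' p) (hF' : F' ≠ 0) (hM : ∀ᶠ x in 𝓝 p, x ∈ M ↔ F x = F p) :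
    tangentPlane M p = F'.ker := by
  have hr : F'.range = ⊤ := by
    rw [LinearMap.range_eq_top]
    apply LinearMap.surjective
    contrapose! hF'
    exact ContinuousLinearMap.coe_injective hF'
  apply le_antisymm
  -- `F` is constant on `M`, so `F'` and `0` are both derivatives of `F` within `M` and agree on the
  -- tangent cone.
  · refine Submodule.span_le.2 fun v hv => ?_
    have hzero : HasFDerivWithinAt F (0 : E →L[ℝ] ℝ) M p := by
      refine (hasFDerivWithinAt_const (F p) p M).congr_of_eventuallyEq ?_ rfl
      filter_upwards [nhdsWithin_le_nhds hM, self_mem_nhdsWithin] with x hx hxM using hx.1 hxM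
    exact hF.hasFDerivAt.hasFDerivWithinAt.unique_on hzero hv
  · intro v hv
    refine Submodule.subset_span ?_
    -- The implicit function parametrizes the level set by the kernel, and its derivative at `0` is
    -- the inclusion; every kernel vector is therefore tangent.
    have h1 := hF.to_implicitFunction hr
    have h2 : ∀ᶠ y : F'.ker in 𝓝 0, hF.implicitFunction F F' hr (F p) y ∈ M := by
      have t1 : Filter.Tendsto (fun y : F'.ker => (F p, y)) (𝓝 0) (𝓝 (F p, 0)) :=
        (Continuous.prodMk_right (F p)).tendsto 0
      have t2 : Filter.Tendsto (fun y : F'.ker => hF.implicitFunction F F' hr (F p) y) (𝓝 0)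
          (𝓝 p) := by
        have := h1.continuousAt.tendsto
        rwa [hF.implicitFunction_apply_image hr] at this
      filter_upwards [t1.eventually (hF.map_implicitFunction_eq hr), t2.eventually hM]
        with y hy hyM using hyM.2 hy
    have h3 := h1.hasFDerivAt.hasFDerivWithinAt
      (s := {y | hF.implicitFunction F F' hr (F p) y ∈ M}) |>.mapsTo_tangent_cone
    rw [tangentConeAt_of_mem_nhds h2, hF.implicitFunction_apply_image hr] at h3
    exact tangentConeAt_mono (by rintro _ ⟨y, hy, rfl⟩; exact hy) (h3 (Set.mem_univ ⟨v, hv⟩))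

/-- The mean curvature, if the Birkhoff-Gauss map agrees on `M` with an ambient map whose
differential takes values in the tangent plane. -/
theorem trace_eq_zero_of_hasMeanCurvatureAt_zero [FiniteDimensional ℝ E] {M : Set E} {η : E → E}
    {p : E} {D : E →L[ℝ] E} (hH : HasMeanCurvatureAt M η p 0)
    (hD : HasFDerivWithinAt η D M p) (hDT : ∀ v, D v ∈ tangentPlane M p) :
    LinearMap.trace ℝ E (D : E →ₗ[ℝ] E) = 0 := by
  obtain ⟨L, hL, hLT, h0⟩ := hH
  have hrestr : (L : E →ₗ[ℝ] E).restrict hLT =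
      (D : E →ₗ[ℝ] E).restrict (p := tangentPlane M p) (fun v _ => hDT v) := by
    have heq : Set.EqOn (L : E →ₗ[ℝ] E) (D : E →ₗ[ℝ] E) (tangentPlane M p) :=
      LinearMap.eqOn_span' (hL.unique_on hD)
    ext v
    exact heq v.2
  -- As `D` maps the whole space into the tangent plane, its trace equals that of its restriction.
  rw [hrestr, LinearMap.trace_restrict_eq_of_forall_mem _ _ hDT] at h0
  linarith

end TangentPlane

/-! ### Odd roots of real numbers. -/

section OddRoot

theorem oddRoot_pow {n : ℕ} (hn : Odd n) (t : ℝ) : oddRoot n t ^ n = t := by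
  have h0 : n ≠ 0 := by rintro rfl; simp at hn
  unfold oddRoot
  rw [mul_pow, one_div, Real.rpow_inv_natCast_pow (abs_nonneg t) h0]
  rcases lt_trichotomy t 0 with h | h | h
  · simp [sign_neg h, abs_of_neg h, hn.neg_one_pow]
  · simp [h]
  · simp [sign_pos h, abs_of_pos h]

theorem contDiffAt_oddRoot (n : ℕ) {t : ℝ} (ht : t ≠ 0) : ContDiffAt ℝ ∞ (oddRoot n) t := by
  have h1 : ContDiffAt ℝ ∞ (fun s : ℝ => (SignType.sign t : ℝ) * |s| ^ (1 / (n : ℝ))) t :=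
    contDiffAt_const.mul ((contDiffAt_abs ht).rpow_const_of_ne (abs_ne_zero.2 ht))
  refine h1.congr_of_eventuallyEq ?_
  rcases lt_or_gt_of_ne ht with h | h
  · filter_upwards [eventually_lt_nhds h] with s hs
    simp [oddRoot, sign_neg h, sign_neg hs]
  · filter_upwards [eventually_gt_nhds h] with s hs
    simp [oddRoot, sign_pos h, sign_pos hs]

theorem odd_two_mul_sub_one {m : ℕ} (hm : 2 ≤ m) : Odd (2 * m - 1) :=
  ⟨m - 1, by omega⟩

theorem evenOddPow_pos {m : ℕ} (hm : 2 ≤ m) {t : ℝ} (ht : t ≠ 0) : 0 < evenOddPow m t := by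
  unfold evenOddPow
  refine (even_two_mul m).pow_pos fun h => ht ?_
  rw [← oddRoot_pow (odd_two_mul_sub_one hm) t, h]
  exact zero_pow (by omega)

end OddRoot

/-! ### Linear forms and the unit sphere of the `2m`-norm. -/

section Space

variable {m : ℕ}

/-- The linear form with coefficients `c`. -/
noncomputable def coordForm (m : ℕ) [Fact (2 ≤ m)] (c : Fin 3 → ℝ) : Space2m m →L[ℝ] ℝ :=
  ∑ i, c i • PiLp.proj _ (fun _ : Fin 3 => ℝ) i

variable [Fact (2 ≤ m)]

theorem coordForm_apply (c : Fin 3 → ℝ) (v : Space2m m) : coordForm m c v = ∑ i, c i * v i := by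
  simp [coordForm]

theorem coordForm_ne_zero {c : Fin 3 → ℝ} {i : Fin 3} (hc : c i ≠ 0) : coordForm m c ≠ 0 := by
  intro h
  have := congrArg (fun L : Space2m m →L[ℝ] ℝ => L (PiLp.single _ i 1)) h
  simp [coordForm_apply] at this
  exact hc this

/-- Proportionality of linear forms with the same kernel. -/
theorem exists_smul_of_ker_coordForm_eq {c d : Fin 3 → ℝ} (hc : ∀ i, c i ≠ 0)
    (h : (coordForm m d).ker = (coordForm m c).ker) : ∃ l : ℝ, ∀ i, d i = l * c i := by
  have key : ∀ i j : Fin 3, i ≠ j → d i * c j = d j * c i := by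
    intro i j hij
    -- The vector `cⱼ eᵢ - cᵢ eⱼ` lies in the kernel of `c`, hence in that of `d`.
    have hv : (PiLp.single _ i (c j) - PiLp.single _ j (c i) : Space2m m) ∈ (coordForm m d).ker := by
      rw [h]
      simp [coordForm_apply, mul_sub, Finset.sum_sub_distrib]
      ring
    simp [coordForm_apply, mul_sub, Finset.sum_sub_distrib] at hv
    linarith
  refine ⟨d 0 / c 0, fun i => ?_⟩
  have := hc 0
  by_cases hi : i = 0
  · subst hi; field_simp
  · field_simp
    exact key _ _ hi

theorem hasStrictFDerivAt_separable {φ : Fin 3 → ℝ → ℝ} {c : Fin 3 → ℝ} {p : Space2m m}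
    (h : ∀ i, HasStrictDerivAt (φ i) (c i) (p i)) :
    HasStrictFDerivAt (fun x : Space2m m => ∑ i, φ i (x i)) (coordForm m c) p := by
  unfold coordForm
  refine HasStrictFDerivAt.fun_sum fun i _ => ?_
  exact (h i).comp_hasStrictFDerivAt p (PiLp.hasStrictFDerivAt_apply _ (𝕜 := ℝ) p i)

theorem norm_eq_one_iff_sum (x : Space2m m) : ‖x‖ = 1 ↔ ∑ i, x i ^ (2 * m) = 1 := by
  have hm : 2 ≤ m := Fact.out
  have h0 : 2 * m ≠ 0 := by omega
  rw [PiLp.norm_eq_of_nat (2 * m) rfl x]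
  have e : ∀ i, ‖x i‖ ^ (2 * m) = x i ^ (2 * m) := fun i => (even_two_mul m).pow_abs _
  simp only [e]
  have hn : 0 ≤ ∑ i, x i ^ (2 * m) := Finset.sum_nonneg fun i _ => (even_two_mul m).pow_nonneg _
  constructor
  · intro h
    have := congrArg (· ^ (2 * m)) h
    simpa only [one_div, Real.rpow_inv_natCast_pow hn h0, one_pow] using this
  · intro h
    rw [h, Real.one_rpow]

/-- The sphere is a level set of `∑ xᵢ ^ (2m)`, whose differential is `2m` times the given form and
is nonzero because `v ≠ 0`. -/
theorem tangentPlane_sphere {v : Space2m m} (hv : ‖v‖ = 1) :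
    tangentPlane (Metric.sphere (0 : Space2m m) 1) v =
      (coordForm m fun i => v i ^ (2 * m - 1)).ker := by
  have hm : 2 ≤ m := Fact.out
  have hs := (norm_eq_one_iff_sum v).1 hv
  have hF : HasStrictFDerivAt (fun x : Space2m m => ∑ i, (fun t : ℝ => t ^ (2 * m)) (x i))
      (coordForm m fun i => ((2 * m : ℕ) : ℝ) * v i ^ (2 * m - 1)) v :=
    hasStrictFDerivAt_separable (φ := fun _ t => t ^ (2 * m)) fun i => hasStrictDerivAt_pow _ _
  have hsm : (coordForm m fun i => ((2 * m : ℕ) : ℝ) * v i ^ (2 * m - 1)) =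
      ((2 * m : ℕ) : ℝ) • coordForm m fun i => v i ^ (2 * m - 1) := by
    ext x
    simp only [coordForm_apply, _root_.smul_apply, smul_eq_mul, Finset.mul_sum,
      mul_assoc]
  have h2m : ((2 * m : ℕ) : ℝ) ≠ 0 := by
    have : 2 * m ≠ 0 := by omega
    exact_mod_cast this
  rw [tangentPlane_eq_ker hF _ _]
  · rw [hsm]
    ext x
    simp only [LinearMap.mem_ker, ContinuousLinearMap.coe_coe, _root_.smul_apply,
      smul_eq_mul, mul_eq_zero, h2m, false_or]
  · obtain ⟨i, hi⟩ : ∃ i, v i ≠ 0 := by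
      by_contra! hcon
      simp [hcon, show m ≠ 0 by omega] at hs
    exact coordForm_ne_zero (i := i) (mul_ne_zero h2m (pow_ne_zero _ hi))
  · filter_upwards with x
    rw [mem_sphere_zero_iff_norm, norm_eq_one_iff_sum]
    simp only [hs]

end Space

/-! ### The differential equation expressing minimality. -/

section Minimal

variable {m : ℕ} [Fact (2 ≤ m)]

/-- The differential of the normalized normal `x ↦ ρ(x) (A₁(x₁), A₂(x₂), A₃(x₃))`. -/
noncomputable def normalDeriv (m : ℕ) [Fact (2 ≤ m)] (ρ S : ℝ) (A A' c : Fin 3 → ℝ) :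
    Space2m m →L[ℝ] Space2m m :=
  ((PiLp.continuousLinearEquiv ((2 * m : ℕ) : ℝ≥0∞) ℝ fun _ : Fin 3 => ℝ).symm :
    (Fin 3 → ℝ) →L[ℝ] Space2m m).comp
  (ContinuousLinearMap.pi fun i => (ρ * A' i) • PiLp.proj _ (fun _ : Fin 3 => ℝ) i -
    (ρ / S * A i) • coordForm m fun j => c j * A' j)

theorem normalDeriv_apply (ρ S : ℝ) (A A' c : Fin 3 → ℝ) (v : Space2m m) (i : Fin 3) :
    normalDeriv m ρ S A A' c v i = ρ * A' i * v i - ρ / S * A i * ∑ j, c j * A' j * v j := by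
  simp [normalDeriv, coordForm_apply]

theorem trace_normalDeriv (ρ S : ℝ) (A A' c : Fin 3 → ℝ) :
    LinearMap.trace ℝ (Space2m m) (normalDeriv m ρ S A A' c : Space2m m →ₗ[ℝ] Space2m m) =
      ∑ i, (ρ * A' i - ρ / S * A i * (c i * A' i)) := by
  rw [LinearMap.trace_eq_matrix_trace ℝ (PiLp.basisFun ((2 * m : ℕ) : ℝ≥0∞) ℝ (Fin 3)),
    Matrix.trace]
  refine Finset.sum_congr rfl fun i _ => ?_
  rw [Matrix.diag_apply, LinearMap.toMatrix_apply, PiLp.basisFun_repr, PiLp.basisFun_apply]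
  change normalDeriv m ρ S A A' c _ i = _
  rw [normalDeriv_apply]
  simp

/-- The functions `Aᵢ` are the odd roots of `cᵢ`, and `ρ = S ^ (-1 / (2m))` with
`S = ∑ Aᵢ ^ (2m)`. -/
theorem hasFDerivAt_normal {A : Fin 3 → ℝ → ℝ} {A' : Fin 3 → ℝ} {p : Space2m m}
    (hA : ∀ i, HasDerivAt (A i) (A' i) (p i)) (h0 : 0 < ∑ i, A i (p i) ^ (2 * m)) :
    HasFDerivAt (fun x : Space2m m => (WithLp.toLp _ fun i =>
        (∑ j, A j (x j) ^ (2 * m)) ^ (-(1 / ((2 * m : ℕ) : ℝ))) * A i (x i) : Space2m m))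
      (normalDeriv m ((∑ j, A j (p j) ^ (2 * m)) ^ (-(1 / ((2 * m : ℕ) : ℝ))))
        (∑ j, A j (p j) ^ (2 * m)) (fun i => A i (p i)) A' fun i => A i (p i) ^ (2 * m - 1)) p := by
  have hm : 2 ≤ m := Fact.out
  have h2m : ((2 * m : ℕ) : ℝ) ≠ 0 := by
    have : 2 * m ≠ 0 := by omega
    exact_mod_cast this
  have hAc : ∀ i, HasFDerivAt (fun x : Space2m m => A i (x i))
      (A' i • PiLp.proj (𝕜 := ℝ) ((2 * m : ℕ) : ℝ≥0∞) (fun _ : Fin 3 => ℝ) i) p := fun i =>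
    (hA i).comp_hasFDerivAt p (PiLp.hasFDerivAt_apply ((2 * m : ℕ) : ℝ≥0∞)
      (E := fun _ : Fin 3 => ℝ) (𝕜 := ℝ) p i)
  have hS : HasFDerivAt (fun x : Space2m m => ∑ j, A j (x j) ^ (2 * m))
      (∑ j, (((2 * m : ℕ) : ℝ) * A j (p j) ^ (2 * m - 1)) •
        A' j • PiLp.proj (𝕜 := ℝ) ((2 * m : ℕ) : ℝ≥0∞) (fun _ : Fin 3 => ℝ) j) p := by
    refine HasFDerivAt.fun_sum fun j _ => ?_
    simpa using (hAc j).pow (2 * m)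
  have hρ := hS.rpow_const (p := -(1 / ((2 * m : ℕ) : ℝ))) (Or.inl h0.ne')
  rw [← hasFDerivWithinAt_univ, hasFDerivWithinAt_piLp]
  intro i
  rw [hasFDerivWithinAt_univ]
  refine (hρ.mul (hAc i)).congr_fderiv ?_
  ext v
  rw [ContinuousLinearMap.comp_apply, PiLp.proj_apply, normalDeriv_apply]
  -- The exponent `-1/(2m)` cancels the factor `2m` from the powers, leaving the coefficient `-ρ /
  -- S`.
  rw [Real.rpow_sub_one h0.ne']
  simp only [_root_.add_apply, _root_.smul_apply, _root_.sum_apply, smul_eq_mul, PiLp.proj_apply]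
  have e : ∑ j, ((2 * m : ℕ) : ℝ) * A j (p j) ^ (2 * m - 1) * (A' j * v j) =
      ((2 * m : ℕ) : ℝ) * ∑ j, A j (p j) ^ (2 * m - 1) * A' j * v j := by
    rw [Finset.mul_sum]
    exact Finset.sum_congr rfl fun j _ => by ring
  rw [e]
  field_simp
  ring

/-- The equation satisfied by minimal surfaces `∑ φᵢ(xᵢ) = 0`. -/
theorem minimal_separable_equation {φ : Fin 3 → ℝ → ℝ} {M : Set (Space2m m)} {A' : Fin 3 → ℝ}
    (hM : ∀ p ∈ M, ∀ᶠ x in 𝓝 p, x ∈ M ↔ ∑ i, φ i (x i) = 0)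
    (hφ : ∀ p ∈ M, ∀ i, HasStrictDerivAt (φ i) (deriv (φ i) (p i)) (p i))
    (hφ0 : ∀ p ∈ M, ∀ i, deriv (φ i) (p i) ≠ 0) (hmin : IsMinimalSurface M)
    {p : Space2m m} (hp : p ∈ M)
    (hA : ∀ i, HasDerivAt (fun t => oddRoot (2 * m - 1) (deriv (φ i) t)) (A' i) (p i)) :
    ∑ i, A' i * (∑ j, evenOddPow m (deriv (φ j) (p j)) - evenOddPow m (deriv (φ i) (p i))) = 0 := by
  have hm : 2 ≤ m := Fact.out
  have hodd := odd_two_mul_sub_one hm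
  have h2m : 2 * m ≠ 0 := by omega
  obtain ⟨U, hU, hpU, η, ⟨hη, hBG⟩, hH⟩ := hmin p hp
  obtain ⟨A, hAdef⟩ : ∃ A : Fin 3 → ℝ → ℝ, A = fun i t => oddRoot (2 * m - 1) (deriv (φ i) t) :=
    ⟨_, rfl⟩
  have hApow : ∀ i t, A i t ^ (2 * m - 1) = deriv (φ i) t := by
    intro i t; rw [hAdef]; exact oddRoot_pow hodd _
  have hAeven : ∀ i t, A i t ^ (2 * m) = evenOddPow m (deriv (φ i) t) := by
    intro i t; rw [hAdef]; rfl
  have hA0 : ∀ q ∈ M, ∀ i, A i (q i) ≠ 0 := by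
    intro q hq i h
    have := hApow i (q i)
    rw [h, zero_pow (by omega)] at this
    exact hφ0 q hq i this.symm
  have hSpos : ∀ q ∈ M, 0 < ∑ j, A j (q j) ^ (2 * m) := fun q hq =>
    Finset.sum_pos (fun i _ => (even_two_mul m).pow_pos (hA0 q hq i)) Finset.univ_nonempty
  have hT : ∀ q ∈ M ∩ U, tangentPlane (M ∩ U) q =
      (coordForm m fun i => deriv (φ i) (q i)).ker := by
    intro q hq
    refine tangentPlane_eq_ker (hasStrictFDerivAt_separable (hφ q hq.1))
      (coordForm_ne_zero (i := 0) (hφ0 q hq.1 0)) ?_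
    have hq0 : ∑ i, φ i (q i) = 0 := (hM q hq.1).self_of_nhds.1 hq.1
    filter_upwards [hM q hq.1, hU.mem_nhds hq.2] with x hx hxU
    rw [hq0, Set.mem_inter_iff, hx]
    simp [hxU]
  obtain ⟨ρ, hρdef⟩ : ∃ ρ : Space2m m → ℝ,
      ρ = fun x => (∑ j, A j (x j) ^ (2 * m)) ^ (-(1 / ((2 * m : ℕ) : ℝ))) := ⟨_, rfl⟩
  have hρpos : ∀ q ∈ M, 0 < ρ q := fun q hq => by
    rw [hρdef]; exact Real.rpow_pos_of_pos (hSpos q hq) _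
  have hρpow : ∀ q ∈ M, ρ q ^ (2 * m) * ∑ j, A j (q j) ^ (2 * m) = 1 := by
    intro q hq
    have hS := hSpos q hq
    rw [hρdef]
    simp only
    rw [Real.rpow_neg hS.le, inv_pow, one_div, Real.rpow_inv_natCast_pow hS.le h2m,
      inv_mul_cancel₀ hS.ne']
  -- Equal kernels make `ηᵢ ^ (2m-1)` proportional to `φᵢ'`. Taking odd roots gives `η` proportional
  -- to `A`, and norm one fixes the factor up to sign.
  have hsign : ∀ q ∈ M ∩ U, ∃ σ : ℝ, (σ = 1 ∨ σ = -1) ∧ ∀ i, η q i = σ * (ρ q * A i (q i)) := by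
    intro q hq
    obtain ⟨hn, -, hker⟩ := hBG q hq
    rw [hn, inv_one, one_smul, tangentPlane_sphere hn, hT q hq] at hker
    obtain ⟨l, hl⟩ := exists_smul_of_ker_coordForm_eq (hφ0 q hq.1) hker
    have hη' : ∀ i, η q i = oddRoot (2 * m - 1) l * A i (q i) := by
      intro i
      apply hodd.pow_injective
      simp only [mul_pow, oddRoot_pow hodd, hApow]
      exact hl i
    have h1 := (norm_eq_one_iff_sum (η q)).1 hn
    simp only [hη', mul_pow, ← Finset.mul_sum] at h1
    have h2 := hρpow q hq.1
    have hS := hSpos q hq.1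
    have h3 : oddRoot (2 * m - 1) l ^ (2 * m) = ρ q ^ (2 * m) :=
      mul_right_cancel₀ hS.ne' (h1.trans h2.symm)
    rw [← (even_two_mul m).pow_abs] at h3
    have h4 : |oddRoot (2 * m - 1) l| = ρ q :=
      (pow_left_inj₀ (abs_nonneg _) (hρpos q hq.1).le h2m).1 h3
    rcases eq_or_eq_neg_of_abs_eq h4 with h | h
    · exact ⟨1, Or.inl rfl, fun i => by rw [hη', h]; ring⟩
    · exact ⟨-1, Or.inr rfl, fun i => by rw [hη', h]; ring⟩
  obtain ⟨G, hGdef⟩ : ∃ G : Space2m m → Space2m m,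
      G = fun x => WithLp.toLp _ fun i => ρ x * A i (x i) := ⟨_, rfl⟩
  have hG : HasFDerivAt G (normalDeriv m (ρ p) (∑ j, A j (p j) ^ (2 * m)) (fun i => A i (p i)) A'
      fun i => A i (p i) ^ (2 * m - 1)) p := by
    rw [hGdef, hρdef]
    exact hasFDerivAt_normal (by rw [hAdef]; exact hA) (hSpos p hp)
  have hGi : ∀ q i, G q i = ρ q * A i (q i) := by intro q i; rw [hGdef]
  have hG0 : ∀ q ∈ M, G q 0 ≠ 0 := fun q hq => by
    rw [hGi]; exact mul_ne_zero (hρpos q hq).ne' (hA0 q hq 0)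
  have hpMU : p ∈ M ∩ U := ⟨hp, hpU⟩
  obtain ⟨σ, hσ, hσp⟩ := hsign p hpMU
  -- The sign is recovered as a continuous ratio with values `±1`, hence is constant near `p`.
  have hratio : ContinuousWithinAt (fun x => η x 0 / G x 0) (M ∩ U) p := by
    have c : Continuous fun x : Space2m m => x 0 :=
      (PiLp.proj (𝕜 := ℝ) ((2 * m : ℕ) : ℝ≥0∞) (fun _ : Fin 3 => ℝ) 0).continuous
    exact (c.continuousAt.comp_continuousWithinAt (hη.continuousOn p hpMU)).div
      (c.continuousAt.comp_continuousWithinAt hG.continuousAt.continuousWithinAt) (hG0 p hp)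
  have hpr : η p 0 / G p 0 = σ := by
    rw [hσp, hGi, mul_div_assoc, div_self (hGi p 0 ▸ hG0 p hp), mul_one]
  have heq : η =ᶠ[𝓝[M ∩ U] p] fun x => σ • G x := by
    -- Radius one separates `1` from `-1`.
    have hev := hratio.eventually (Metric.ball_mem_nhds _ one_pos)
    filter_upwards [hev, self_mem_nhdsWithin] with x hx hxM
    obtain ⟨τ, hτ, hτx⟩ := hsign x hxM
    have hxr : η x 0 / G x 0 = τ := by
      rw [hτx, hGi, mul_div_assoc, div_self (hGi x 0 ▸ hG0 x hxM.1), mul_one]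
    rw [hxr, hpr, Real.dist_eq] at hx
    have hστ : τ = σ := by
      rcases hσ with rfl | rfl <;> rcases hτ with rfl | rfl <;> first | rfl | (norm_num at hx)
    ext i
    rw [hτx, hστ, ← hGi]
    rfl
  have hD := (hG.const_smul σ).hasFDerivWithinAt.congr_of_eventuallyEq heq
    (heq.self_of_nhdsWithin hpMU)
  have hS := hSpos p hp
  have hcA : ∀ i, deriv (φ i) (p i) * A i (p i) = A i (p i) ^ (2 * m) := by
    intro i
    rw [← hApow, ← pow_succ]
    congr 1
    omega
  -- The image of the differential is tangent because `∑ φᵢ' Aᵢ = ∑ Aᵢ ^ (2m) = S`, which makes the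
  -- two terms cancel.
  have htr := trace_eq_zero_of_hasMeanCurvatureAt_zero (hH p hpMU) hD (by
    intro v
    rw [hT p hpMU]
    change coordForm m _ (σ • normalDeriv m _ _ _ _ _ v) = 0
    rw [map_smul, coordForm_apply]
    simp only [normalDeriv_apply, hApow]
    have e : ∀ s : ℝ, ∑ i, deriv (φ i) (p i) * (ρ p * A' i * v i -
        ρ p / (∑ j, A j (p j) ^ (2 * m)) * A i (p i) * s) =
        ρ p * ∑ i, deriv (φ i) (p i) * A' i * v i -
        ρ p / (∑ j, A j (p j) ^ (2 * m)) * s * ∑ i, A i (p i) ^ (2 * m) := by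
      intro s
      rw [Finset.mul_sum, Finset.mul_sum, ← Finset.sum_sub_distrib]
      refine Finset.sum_congr rfl fun i _ => ?_
      rw [← hcA]
      ring
    rw [e]
    field_simp
    simp)
  rw [ContinuousLinearMap.toLinearMap_smul, map_smul, trace_normalDeriv, smul_eq_mul,
    mul_eq_zero] at htr
  have hσ0 : σ ≠ 0 := by rcases hσ with rfl | rfl <;> norm_num
  have htr := htr.resolve_left hσ0
  simp only [← hAeven]
  have hρ := hρpos p hp
  -- The trace is `ρ / S` times the required sum.
  have hfac : ρ p / (∑ j, A j (p j) ^ (2 * m)) ≠ 0 := by positivity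
  apply mul_left_cancel₀ hfac
  rw [mul_zero, ← htr, Finset.mul_sum]
  refine Finset.sum_congr rfl fun i _ => ?_
  rw [hApow, ← hcA i]
  field_simp

end Minimal

/-! ### Powers of the derivative as functions of the value. -/

theorem ContDiffAt.exists_local_inverse {f : ℝ → ℝ} {x : ℝ} (hf : ContDiffAt ℝ ∞ f x)
    (h0 : deriv f x ≠ 0) : ∃ ψ : ℝ → ℝ, ContDiffAt ℝ ∞ ψ (f x) ∧ ψ (f x) = x ∧
      (∀ᶠ u in 𝓝 (f x), f (ψ u) = u) ∧ ∀ᶠ t in 𝓝 x, ψ (f t) = t := by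
  have hs : HasStrictFDerivAt f
      (ContinuousLinearEquiv.unitsEquivAut ℝ (Units.mk0 _ h0) : ℝ →L[ℝ] ℝ) x :=
    (hf.hasStrictDerivAt (by simp)).hasStrictFDerivAt_equiv h0
  exact ⟨hs.localInverse f _ x, hf.to_localInverse hs.hasFDerivAt (by simp),
    hs.localInverse_apply_image, hs.eventually_right_inverse, hs.eventually_left_inverse⟩

theorem injOn_of_deriv_ne_zero {f : ℝ → ℝ} {I : Set ℝ} (hI : IsPreconnected I)
    (hf : ∀ t ∈ I, DifferentiableAt ℝ f t) (h0 : ∀ t ∈ I, deriv f t ≠ 0) : Set.InjOn f I := by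
  have aux : ∀ s ∈ I, ∀ t ∈ I, s < t → f s ≠ f t := by
    intro s hs t ht hst heq
    have hsub : Set.Icc s t ⊆ I := hI.ordConnected.out hs ht
    obtain ⟨c, hc, hc0⟩ := exists_deriv_eq_zero hst
      (fun r hr => (hf r (hsub hr)).continuousAt.continuousWithinAt) heq
    exact h0 c (hsub (Set.Ioo_subset_Icc_self hc)) hc0
  intro s hs t ht heq
  by_contra hne
  rcases lt_or_gt_of_ne hne with h | h
  · exact aux s hs t ht h heq
  · exact aux t ht s hs h heq.symm

/-- The power of the derivative as a function of the value. -/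
theorem exists_power_as_function {m : ℕ} (hm : 2 ≤ m) {f : ℝ → ℝ} {I : Set ℝ} (hIo : IsOpen I)
    (hI : IsPreconnected I) (hf : ∀ t ∈ I, ContDiffAt ℝ ∞ f t) (h0 : ∀ t ∈ I, deriv f t ≠ 0) :
    ∃ X : ℝ → ℝ, ∀ t ∈ I, X (f t) = evenOddPow m (deriv f t) ∧ ContDiffAt ℝ ∞ X (f t) ∧
      (∃ A', HasDerivAt (fun t => oddRoot (2 * m - 1) (deriv f t)) A' t ∧
        deriv X (f t) = 2 * m * A') ∧
      (deriv (deriv f) t ≠ 0 → deriv X (f t) ≠ 0) := by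
  have hinj := injOn_of_deriv_ne_zero hI (fun t ht => (hf t ht).differentiableAt (by simp)) h0
  have hodd := odd_two_mul_sub_one hm
  -- A global inverse on `I` defines `X`; injectivity identifies it near each value with the smooth
  -- local inverse `ψ`.
  refine ⟨fun u => evenOddPow m (deriv f (Function.invFunOn f I u)), fun t ht => ?_⟩
  obtain ⟨ψ, hψ, hψt, hr, -⟩ := (hf t ht).exists_local_inverse (h0 t ht)
  have heq : (fun u => evenOddPow m (deriv f (Function.invFunOn f I u))) =ᶠ[𝓝 (f t)]
      fun u => oddRoot (2 * m - 1) (deriv f (ψ u)) ^ (2 * m) := by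
    have hψI : ∀ᶠ u in 𝓝 (f t), ψ u ∈ I :=
      hψ.continuousAt.eventually_mem (by rw [hψt]; exact hIo.mem_nhds ht)
    filter_upwards [hr, hψI] with u hu huI
    have : Function.invFunOn f I u = ψ u :=
      hinj (Function.invFunOn_mem ⟨ψ u, huI, hu⟩) huI
        ((Function.invFunOn_eq ⟨ψ u, huI, hu⟩).trans hu.symm)
    rw [this]
    rfl
  have hA : ContDiffAt ℝ ∞ (fun t => oddRoot (2 * m - 1) (deriv f t)) t :=
    ContDiffAt.comp (g := oddRoot (2 * m - 1)) t (contDiffAt_oddRoot _ (h0 t ht))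
      (hf t ht).deriv_of_infty
  have hAψ : ContDiffAt ℝ ∞ (fun u => oddRoot (2 * m - 1) (deriv f (ψ u))) (f t) :=
    ContDiffAt.comp (g := fun t => oddRoot (2 * m - 1) (deriv f t)) (f t) (by rwa [hψt]) hψ
  have hder := hA.hasDerivAt_of_infty
  obtain ⟨A', hA'⟩ : ∃ A', A' = deriv (fun t => oddRoot (2 * m - 1) (deriv f t)) t := ⟨_, rfl⟩
  rw [← hA'] at hder
  have hψ' : HasDerivAt ψ (deriv f t)⁻¹ (f t) := by
    refine HasDerivAt.of_local_left_inverse hψ.continuousAt ?_ (h0 t ht) hr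
    rw [hψt]
    exact (hf t ht).hasDerivAt_of_infty
  have hXder : HasDerivAt (fun u => evenOddPow m (deriv f (Function.invFunOn f I u)))
      (2 * m * A') (f t) := by
    have h1 : HasDerivAt (fun u => oddRoot (2 * m - 1) (deriv f (ψ u))) (A' * (deriv f t)⁻¹)
        (f t) :=
      HasDerivAt.comp (h₂ := fun t => oddRoot (2 * m - 1) (deriv f t)) (f t) (by rwa [hψt]) hψ'
    have h2 := (h1.pow (2 * m)).congr_of_eventuallyEq heq
    -- The chain rule gives `2m A ^ (2m-1) A' / f'`, and `A ^ (2m-1) = f'`.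
    refine h2.congr_deriv ?_
    rw [hψt, oddRoot_pow hodd]
    have := h0 t ht
    field_simp
    push_cast
    ring
  refine ⟨?_, (hAψ.pow (2 * m)).congr_of_eventuallyEq heq, ⟨A', hder, hXder.deriv⟩, ?_⟩
  · refine heq.self_of_nhds.trans ?_
    simp only [hψt]
    rfl
  · intro h2 hX
    rw [hXder.deriv] at hX
    have hA0 : A' = 0 := by
      have : (m : ℝ) ≠ 0 := by
        have : m ≠ 0 := by omega
        exact_mod_cast this
      simpa [this] using hX
    -- Since `f' = A ^ (2m-1)`, `A' = 0` would force `f'' = 0`.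
    have h3 := hder.pow (2 * m - 1)
    have h4 : (fun t => oddRoot (2 * m - 1) (deriv f t)) ^ (2 * m - 1) = deriv f :=
      funext fun s => oddRoot_pow hodd _
    rw [h4, hA0, mul_zero] at h3
    exact h2 h3.deriv

theorem Fin.eq_or_eq_or_eq_of_distinct {i j k : Fin 3} (hij : i ≠ j) (hjk : j ≠ k) (hik : i ≠ k)
    (l : Fin 3) : l = i ∨ l = j ∨ l = k := by
  revert i j k l; decide

theorem Fin.sum_univ_of_distinct {i j k : Fin 3} (hij : i ≠ j) (hjk : j ≠ k) (hik : i ≠ k)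
    (F : Fin 3 → ℝ) : ∑ l, F l = F i + F j + F k := by
  have : (Finset.univ : Finset (Fin 3)) = {i, j, k} := by
    revert i j k; decide
  rw [this, Finset.sum_insert (by simp [hij, hik]), Finset.sum_insert (by simp [hjk]),
    Finset.sum_singleton]
  ring

/-! ### Local structure of separable surfaces, and the translation case. -/

section SeparableSurface

theorem continuous_coord {m : ℕ} (i : Fin 3) : Continuous fun x : Space2m m => x i :=
  (PiLp.proj (𝕜 := ℝ) ((2 * m : ℕ) : ℝ≥0∞) (fun _ : Fin 3 => ℝ) i).continuous

variable {m : ℕ} {φ : Fin 3 → ℝ → ℝ} {W : Set (Space2m m)}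

theorem isOpenMap_coord [Fact (2 ≤ m)] (i : Fin 3) : IsOpenMap fun x : Space2m m => x i :=
  (PiLp.proj (𝕜 := ℝ) ((2 * m : ℕ) : ℝ≥0∞) (fun _ : Fin 3 => ℝ) i).isOpenMap
    fun t => ⟨PiLp.single _ i t, by simp⟩

/-- The surface contains all points of the level set near `p`, parametrized by the values
of the `φ i`. -/
theorem exists_local_parametrization (hW : IsOpen W) {p : Space2m m} (hp : p ∈ W)
    (hφ : ∀ i, ContDiffAt ℝ ∞ (φ i) (p i)) (h0 : ∀ i, deriv (φ i) (p i) ≠ 0) :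
    ∃ ψ : Fin 3 → ℝ → ℝ, (∀ i, ∀ᶠ t in 𝓝 (p i), ψ i (φ i t) = t) ∧
      ∀ᶠ w : Fin 3 → ℝ in 𝓝 fun i => φ i (p i),
        (∀ i, φ i (ψ i (w i)) = w i) ∧ (WithLp.toLp _ fun i => ψ i (w i) : Space2m m) ∈ W := by
  choose ψ hψ hψp hr hl using fun i => (hφ i).exists_local_inverse (h0 i)
  refine ⟨ψ, hl, ?_⟩
  refine Filter.Eventually.and ?_ ?_
  · rw [Filter.eventually_all]
    intro i
    have hc : Filter.Tendsto (fun w : Fin 3 → ℝ => w i) (𝓝 fun i => φ i (p i))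
        (𝓝 (φ i (p i))) := (continuous_apply i).tendsto _
    exact hc.eventually (hr i)
  · have hc : ContinuousAt (fun w : Fin 3 → ℝ => (WithLp.toLp _ fun i => ψ i (w i) : Space2m m))
        (fun i => φ i (p i)) := by
      refine (PiLp.continuous_toLp _ _).continuousAt.comp ?_
      refine continuousAt_pi.2 fun i => ?_
      exact ContinuousAt.comp (g := ψ i) (hψ i).continuousAt (continuous_apply i).continuousAt
    refine hc.eventually_mem ?_
    simp only [hψp]
    exact hW.mem_nhds hp

variable {M : Set (Space2m m)}

/-- Nearby `(u, v)` are realized on `M` by inverting each function separately, with third value `-u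
- v`. This image is the domain of the functional equation. -/
theorem isOpen_values
    (hW : IsOpen W) (hM : M = {x | x ∈ W ∧ ∑ i, φ i (x i) = 0})
    (hφ : ∀ p ∈ M, ∀ i, ContDiffAt ℝ ∞ (φ i) (p i)) (h0 : ∀ p ∈ M, ∀ i, deriv (φ i) (p i) ≠ 0) :
    IsOpen ((fun x : Space2m m => (φ 0 (x 0), φ 1 (x 1))) '' M) := by
  rw [isOpen_iff_mem_nhds]
  rintro _ ⟨p, hp, rfl⟩
  have hp' : p ∈ W ∧ ∑ i, φ i (p i) = 0 := by rw [hM] at hp; exact hp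
  obtain ⟨ψ, -, hψ⟩ := exists_local_parametrization hW hp'.1 (hφ p hp) (h0 p hp)
  have hc : Continuous fun q : ℝ × ℝ => (![q.1, q.2, -q.1 - q.2] : Fin 3 → ℝ) := by
    refine continuous_pi fun i => ?_
    fin_cases i <;> simp <;> fun_prop
  have ht := hc.tendsto (φ 0 (p 0), φ 1 (p 1))
  have hlim : ![φ 0 (p 0), φ 1 (p 1), -φ 0 (p 0) - φ 1 (p 1)] = fun i => φ i (p i) := by
    have := hp'.2
    rw [Fin.sum_univ_three] at this
    ext i
    fin_cases i
    · rfl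
    · rfl
    · simp; linarith
  rw [hlim] at ht
  filter_upwards [ht.eventually hψ] with q hq
  refine ⟨WithLp.toLp _ fun i => ψ i (![q.1, q.2, -q.1 - q.2] i), ?_, ?_⟩
  · rw [hM]
    refine ⟨hq.2, ?_⟩
    simp only [hq.1]
    simp [Fin.sum_univ_three]
  · exact Prod.ext (hq.1 0) (hq.1 1)

/-- Two coordinates can be varied freely and the third solved for; the image serves as the domain of
the translation graph. -/
theorem isOpen_coord_pairs
    (hW : IsOpen W) (hM : M = {x | x ∈ W ∧ ∑ i, φ i (x i) = 0})
    (hφ : ∀ p ∈ M, ∀ i, ContDiffAt ℝ ∞ (φ i) (p i)) (h0 : ∀ p ∈ M, ∀ i, deriv (φ i) (p i) ≠ 0)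
    {i j k : Fin 3} (hij : i ≠ j) (hjk : j ≠ k) (hik : i ≠ k) :
    IsOpen ((fun x : Space2m m => (x i, x j)) '' M) := by
  rw [isOpen_iff_mem_nhds]
  rintro _ ⟨p, hp, rfl⟩
  have hp' : p ∈ W ∧ ∑ i, φ i (p i) = 0 := by rw [hM] at hp; exact hp
  obtain ⟨ψ, hl, hψ⟩ := exists_local_parametrization hW hp'.1 (hφ p hp) (h0 p hp)
  obtain ⟨w, hw⟩ : ∃ w : ℝ × ℝ → Fin 3 → ℝ, w = fun q l => if l = i then φ i q.1 else
    if l = j then φ j q.2 else -φ i q.1 - φ j q.2 := ⟨_, rfl⟩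
  have wi : ∀ q, w q i = φ i q.1 := fun q => by simp [hw]
  have wj : ∀ q, w q j = φ j q.2 := fun q => by simp [hw, hij.symm]
  have wk : ∀ q, w q k = -φ i q.1 - φ j q.2 := fun q => by simp [hw, hik.symm, hjk.symm]
  have c1 : ContinuousAt (fun q : ℝ × ℝ => φ i q.1) (p i, p j) :=
    ContinuousAt.comp (g := φ i) (hφ p hp i).continuousAt continuousAt_fst
  have c2 : ContinuousAt (fun q : ℝ × ℝ => φ j q.2) (p i, p j) :=
    ContinuousAt.comp (g := φ j) (hφ p hp j).continuousAt continuousAt_snd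
  have hc : ContinuousAt w (p i, p j) := by
    refine continuousAt_pi.2 fun l => ?_
    rw [hw]
    simp only
    split_ifs
    · exact c1
    · exact c2
    · exact c1.neg.sub c2
  have ht := hc.tendsto
  have hlim : w (p i, p j) = fun l => φ l (p l) := by
    have := hp'.2
    rw [Fin.sum_univ_of_distinct hij hjk hik] at this
    ext l
    rw [hw]
    simp only
    split_ifs with h1 h2
    · rw [h1]
    · rw [h2]
    · have hlk : l = k := by
        rcases Fin.eq_or_eq_or_eq_of_distinct hij hjk hik l with h | h | h
        exacts [absurd h h1, absurd h h2, h]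
      rw [hlk]; linarith
  rw [hlim] at ht
  filter_upwards [ht.eventually hψ, continuousAt_fst.eventually (hl i),
    continuousAt_snd.eventually (hl j)] with q hq hqi hqj
  refine ⟨WithLp.toLp _ fun l => ψ l (w q l), ?_, ?_⟩
  · rw [hM]
    refine ⟨hq.2, ?_⟩
    simp only [hq.1]
    rw [Fin.sum_univ_of_distinct hij hjk hik, wi, wj, wk]
    ring
  · refine Prod.ext ?_ ?_
    · simp only [wi, hqi]
    · simp only [wj, hqj]

theorem isOpen_coord_image
    (hW : IsOpen W) (hM : M = {x | x ∈ W ∧ ∑ i, φ i (x i) = 0})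
    (hφ : ∀ p ∈ M, ∀ i, ContDiffAt ℝ ∞ (φ i) (p i)) (h0 : ∀ p ∈ M, ∀ i, deriv (φ i) (p i) ≠ 0)
    (i : Fin 3) : IsOpen ((fun x : Space2m m => x i) '' M) := by
  obtain ⟨j, k, hij, hjk, hik⟩ : ∃ j k : Fin 3, i ≠ j ∧ j ≠ k ∧ i ≠ k := by revert i; decide
  have := isOpenMap_fst _ (isOpen_coord_pairs hW hM hφ h0 hij hjk hik)
  rwa [Set.image_image] at this

/-- If one of the functions is affine, the surface is a translation surface. -/
theorem isTranslationSurface_of_deriv_deriv_eq_zero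
    (hW : IsOpen W) (hM : M = {x | x ∈ W ∧ ∑ i, φ i (x i) = 0})
    (hφ : ∀ p ∈ M, ∀ i, ContDiffAt ℝ ∞ (φ i) (p i)) (h0 : ∀ p ∈ M, ∀ i, deriv (φ i) (p i) ≠ 0)
    (hc : IsConnected M) {k : Fin 3}
    (hk : ∀ p ∈ M, deriv (deriv (φ k)) (p k) = 0) : IsTranslationSurface M := by
  obtain ⟨i, j, hij, hjk, hik⟩ : ∃ i j : Fin 3, i ≠ j ∧ j ≠ k ∧ i ≠ k := by
    clear hk
    revert k
    decide
  have hI := isOpen_coord_image hW hM hφ h0 k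
  have hIc : IsPreconnected ((fun x : Space2m m => x k) '' M) :=
    hc.isPreconnected.image _ (continuous_coord k).continuousOn
  obtain ⟨c, hc1⟩ := exists_eqOn_const (F := deriv (φ k)) hI hIc (by
    rintro _ ⟨p, hp, rfl⟩
    have := (hφ p hp k).deriv_of_infty.hasDerivAt_of_infty
    rwa [hk p hp] at this)
  obtain ⟨d, hd⟩ := exists_eqOn_const (F := fun t => φ k t - c * t) hI hIc (by
    rintro _ ⟨p, hp, rfl⟩
    have h1 := (hφ p hp k).hasDerivAt_of_infty
    rw [hc1 _ ⟨p, hp, rfl⟩] at h1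
    refine (h1.sub ((hasDerivAt_id (p k)).const_mul c)).congr_deriv (by simp))
  have hck : c ≠ 0 := by
    obtain ⟨p, hp⟩ := hc.nonempty
    rw [← hc1 _ ⟨p, hp, rfl⟩]
    exact h0 p hp k
  have hgraph : ∀ p ∈ M, p k = -(φ i (p i) + d) / c + -φ j (p j) / c := by
    intro p hp
    have h1 : ∑ l, φ l (p l) = 0 := by rw [hM] at hp; exact hp.2
    rw [Fin.sum_univ_of_distinct hij hjk hik] at h1
    have h2 := hd _ ⟨p, hp, rfl⟩
    simp only at h2
    field_simp
    linarith
  refine ⟨i, j, k, hij, hjk, hik, (fun x : Space2m m => (x i, x j)) '' M,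
    fun t => -(φ i t + d) / c, fun t => -φ j t / c, isOpen_coord_pairs hW hM hφ h0 hij hjk hik,
    ?_, ?_, ?_, ?_⟩
  · rintro _ ⟨_, ⟨p, hp, rfl⟩, rfl⟩
    exact (((hφ p hp i).add contDiffAt_const).neg.div_const c).contDiffWithinAt
  · rintro _ ⟨_, ⟨p, hp, rfl⟩, rfl⟩
    exact ((hφ p hp j).neg.div_const c).contDiffWithinAt
  · rintro _ ⟨p, hp, rfl⟩
    constructor
    · have := ((hφ p hp i).hasDerivAt_of_infty.add_const d).neg.div_const c
      rw [show deriv (fun t => -(φ i t + d) / c) (p i) = _ from this.deriv]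
      exact div_ne_zero (neg_ne_zero.2 (h0 p hp i)) hck
    · have := (hφ p hp j).hasDerivAt_of_infty.neg.div_const c
      rw [show deriv (fun t => -φ j t / c) (p j) = _ from this.deriv]
      exact div_ne_zero (neg_ne_zero.2 (h0 p hp j)) hck
  · ext x
    constructor
    · exact fun hx => ⟨⟨x, hx, rfl⟩, hgraph x hx⟩
    -- A point of the graph shares two coordinates with some `p ∈ M`, and the graph equation forces
    -- the third, so it is `p` itself and lies in `W`.
    · rintro ⟨⟨p, hp, hpx⟩, hx⟩
      have e1 : p i = x i := congrArg Prod.fst hpx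
      have e2 : p j = x j := congrArg Prod.snd hpx
      have e3 : p k = x k := by rw [hx, hgraph p hp, e1, e2]
      have : x = p := by
        ext l
        rcases Fin.eq_or_eq_or_eq_of_distinct hij hjk hik l with rfl | rfl | rfl
        · exact e1.symm
        · exact e2.symm
        · exact e3.symm
      rwa [this]

end SeparableSurface

/-! ### Assembly of the main theorem. -/

theorem theorem6p1 (m : ℕ) [Fact (2 ≤ m)]
    (W : Set (Space2m m)) (hW : IsOpen W) (f g h : ℝ → ℝ)
    (hf : ContDiffOn ℝ ∞ f ((fun x : Space2m m => x 0) '' W))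
    (hg : ContDiffOn ℝ ∞ g ((fun x : Space2m m => x 1) '' W))
    (hh : ContDiffOn ℝ ∞ h ((fun x : Space2m m => x 2) '' W))
    (M : Set (Space2m m)) (hM : M = separableSurface W f g h)
    (hconn : IsConnected M)
    (hreg : ∀ x ∈ M, deriv f (x 0) ≠ 0 ∧ deriv g (x 1) ≠ 0 ∧ deriv h (x 2) ≠ 0)
    (hmin : IsMinimalSurface M)
    (hnt : ¬ IsTranslationSurface M) :
    ∃ X Y Z : ℝ → ℝ,
      -- `X`, `Y`, `Z` are the given powers of `f'`, `g'`, `h'`, as functions of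
      -- `u = f(x₁)`, `v = g(x₂)`, `w = h(x₃)`; they are smooth and not constant
      (∀ x ∈ M, X (f (x 0)) = evenOddPow m (deriv f (x 0)) ∧
        Y (g (x 1)) = evenOddPow m (deriv g (x 1)) ∧
        Z (h (x 2)) = evenOddPow m (deriv h (x 2))) ∧
      (∀ x ∈ M, ContDiffAt ℝ ∞ X (f (x 0)) ∧ ContDiffAt ℝ ∞ Y (g (x 1)) ∧
        ContDiffAt ℝ ∞ Z (h (x 2))) ∧
      (∃ x ∈ M, deriv X (f (x 0)) ≠ 0 ∧ deriv Y (g (x 1)) ≠ 0 ∧ deriv Z (h (x 2)) ≠ 0) ∧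
      (∀ x ∈ M, (deriv (deriv f) (x 0) ≠ 0 → deriv X (f (x 0)) ≠ 0) ∧
        (deriv (deriv g) (x 1) ≠ 0 → deriv Y (g (x 1)) ≠ 0) ∧
        (deriv (deriv h) (x 2) ≠ 0 → deriv Z (h (x 2)) ≠ 0)) ∧
      ∃ a : ℝ,
        (∀ x ∈ M, iteratedDeriv 3 X (f (x 0)) = a * deriv X (f (x 0)) ∧
          iteratedDeriv 3 Y (g (x 1)) = a * deriv Y (g (x 1)) ∧
          iteratedDeriv 3 Z (h (x 2)) = a * deriv Z (h (x 2))) ∧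
        (∀ x ∈ M, (deriv X (f (x 0)) ≠ 0 →
            iteratedDeriv 3 X (f (x 0)) / deriv X (f (x 0)) = a) ∧
          (deriv Y (g (x 1)) ≠ 0 →
            iteratedDeriv 3 Y (g (x 1)) / deriv Y (g (x 1)) = a) ∧
          (deriv Z (h (x 2)) ≠ 0 →
            iteratedDeriv 3 Z (h (x 2)) / deriv Z (h (x 2)) = a)) ∧
        (0 < a → ∃ b : ℝ, 0 < b ∧ a = b ^ 2 ∧ ∃ p q r : Fin 3 → ℝ, ExpCoeffs p q r ∧
          ∀ x ∈ M,
            X (f (x 0)) = p 0 + q 0 * Real.exp (b * f (x 0)) + r 0 * Real.exp (-(b * f (x 0))) ∧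
            Y (g (x 1)) = p 1 + q 1 * Real.exp (b * g (x 1)) + r 1 * Real.exp (-(b * g (x 1))) ∧
            Z (h (x 2)) = p 2 + q 2 * Real.exp (b * h (x 2)) +
              r 2 * Real.exp (-(b * h (x 2)))) ∧
        (a < 0 → ∃ b : ℝ, 0 < b ∧ a = -b ^ 2 ∧ ∃ p q r : Fin 3 → ℝ, TrigCoeffs p q r ∧
          ∀ x ∈ M,
            X (f (x 0)) = p 0 + q 0 * Real.cos (b * f (x 0)) + r 0 * Real.sin (b * f (x 0)) ∧
            Y (g (x 1)) = p 1 + q 1 * Real.cos (b * g (x 1)) + r 1 * Real.sin (b * g (x 1)) ∧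
            Z (h (x 2)) = p 2 + q 2 * Real.cos (b * h (x 2)) + r 2 * Real.sin (b * h (x 2))) ∧
        (a = 0 → ∃ p q r : Fin 3 → ℝ, QuadCoeffs p q r ∧
          ∀ x ∈ M,
            X (f (x 0)) = p 0 + q 0 * f (x 0) + r 0 * f (x 0) ^ 2 ∧
            Y (g (x 1)) = p 1 + q 1 * g (x 1) + r 1 * g (x 1) ^ 2 ∧
            Z (h (x 2)) = p 2 + q 2 * h (x 2) + r 2 * h (x 2) ^ 2) := by
  have hm : 2 ≤ m := Fact.out
  obtain ⟨φ, hφdef⟩ : ∃ φ : Fin 3 → ℝ → ℝ, φ = ![f, g, h] := ⟨_, rfl⟩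
  have φ0 : φ 0 = f := by rw [hφdef]; rfl
  have φ1 : φ 1 = g := by rw [hφdef]; rfl
  have φ2 : φ 2 = h := by rw [hφdef]; rfl
  have hMφ : M = {x | x ∈ W ∧ ∑ i, φ i (x i) = 0} := by
    rw [hM]
    ext x
    simp [separableSurface, Fin.sum_univ_three, φ0, φ1, φ2]
  have hMW : ∀ p ∈ M, p ∈ W := fun p hp => by rw [hMφ] at hp; exact hp.1
  have hsum : ∀ p ∈ M, f (p 0) + g (p 1) + h (p 2) = 0 := fun p hp => by
    rw [hM] at hp; exact hp.2
  have hφ : ∀ p ∈ M, ∀ i, ContDiffAt ℝ ∞ (φ i) (p i) := by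
    intro p hp i
    have hmem := (isOpenMap_coord i W hW).mem_nhds ⟨p, hMW p hp, rfl⟩
    fin_cases i
    · exact φ0 ▸ hf.contDiffAt hmem
    · exact φ1 ▸ hg.contDiffAt hmem
    · exact φ2 ▸ hh.contDiffAt hmem
  have h0 : ∀ p ∈ M, ∀ i, deriv (φ i) (p i) ≠ 0 := by
    intro p hp i
    obtain ⟨h1, h2, h3⟩ := hreg p hp
    fin_cases i
    · exact φ0 ▸ h1
    · exact φ1 ▸ h2
    · exact φ2 ▸ h3
  have hpow := fun i => exists_power_as_function hm (f := φ i)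
    (isOpen_coord_image hW hMφ hφ h0 i)
    (hconn.isPreconnected.image _ (continuous_coord i).continuousOn)
    (by rintro _ ⟨p, hp, rfl⟩; exact hφ p hp i) (by rintro _ ⟨p, hp, rfl⟩; exact h0 p hp i)
  choose X hX using hpow
  have hXM : ∀ p ∈ M, ∀ i, _ := fun p hp i => hX i (p i) ⟨p, hp, rfl⟩
  -- An identically vanishing derivative would make `φ i` affine on `M`, contradicting `hnt`.
  have hne : ∀ i, ∃ p ∈ M, deriv (X i) (φ i (p i)) ≠ 0 := by
    intro i
    by_contra! hcon
    refine hnt (isTranslationSurface_of_deriv_deriv_eq_zero hW hMφ hφ h0 hconn (k := i) ?_)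
    intro p hp
    by_contra hpne
    exact (hXM p hp i).2.2.2 hpne (hcon p hp)
  have hnear : ∀ p ∈ M, ∀ᶠ x in 𝓝 p, x ∈ M ↔ ∑ i, φ i (x i) = 0 := by
    intro p hp
    filter_upwards [hW.mem_nhds (hMW p hp)] with x hx
    rw [hMφ]
    exact and_iff_right hx
  -- Minimality multiplied by `2m`, since the derivative of `X i` is `2m` times that of the odd
  -- root.
  have hE : ∀ p ∈ M, ∑ i, deriv (X i) (φ i (p i)) *
      (∑ j, X j (φ j (p j)) - X i (φ i (p i))) = 0 := by
    intro p hp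
    choose A' hA' hXA using fun i => (hXM p hp i).2.2.1
    have := minimal_separable_equation hnear
      (fun q hq i => (hφ q hq i).hasStrictDerivAt (by simp)) h0 hmin hp hA'
    simp only [fun i => (hXM p hp i).1, hXA, mul_assoc, ← Finset.mul_sum] at this ⊢
    rw [this, mul_zero, mul_zero]
  have hpos : ∀ p ∈ M, ∀ i, 0 < X i (φ i (p i)) := fun p hp i => by
    rw [(hXM p hp i).1]; exact evenOddPow_pos hm (h0 p hp i)
  obtain ⟨Ω, hΩdef⟩ : ∃ Ω, Ω = (fun x : Space2m m => (φ 0 (x 0), φ 1 (x 1))) '' M := ⟨_, rfl⟩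
  have hΩ : IsOpen Ω := hΩdef ▸ isOpen_values hW hMφ hφ h0
  have hcφ : ∀ i, ContinuousOn (fun x : Space2m m => φ i (x i)) M := fun i p hp =>
    (ContinuousAt.comp (g := φ i) (f := fun x : Space2m m => x i) (hφ p hp i).continuousAt
      (continuous_coord i).continuousAt).continuousWithinAt
  have hΩc : IsConnected Ω := hΩdef ▸ hconn.image _ ((hcφ 0).prodMk (hcφ 1))
  have lift : ∀ {P : ℝ → ℝ → ℝ → Prop}, (∀ p ∈ M, P (φ 0 (p 0)) (φ 1 (p 1)) (φ 2 (p 2))) →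
      ∀ q ∈ Ω, P q.1 q.2 (-q.1 - q.2) := by
    intro P hP q hq
    rw [hΩdef] at hq
    obtain ⟨p, hp, rfl⟩ := hq
    have : -φ 0 (p 0) - φ 1 (p 1) = φ 2 (p 2) := by
      rw [φ0, φ1, φ2]; linarith [hsum p hp]
    simp only [this]
    exact hP p hp
  have mem : ∀ p ∈ M, (φ 0 (p 0), φ 1 (p 1)) ∈ Ω := fun p hp => hΩdef ▸ ⟨p, hp, rfl⟩
  have hw : ∀ p ∈ M, -φ 0 (p 0) - φ 1 (p 1) = φ 2 (p 2) := fun p hp => by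
    rw [φ0, φ1, φ2]; linarith [hsum p hp]
  obtain ⟨hpt, a, ha, hexp, htrig, hquad⟩ := functional_equation_solutions hΩ hΩc
    (X := X 0) (Y := X 1) (Z := X 2)
    (lift (P := fun u _ _ => ContDiffAt ℝ ∞ (X 0) u) fun p hp => (hXM p hp 0).2.1)
    (lift (P := fun _ v _ => ContDiffAt ℝ ∞ (X 1) v) fun p hp => (hXM p hp 1).2.1)
    (lift (P := fun _ _ w => ContDiffAt ℝ ∞ (X 2) w) fun p hp => (hXM p hp 2).2.1)
    (lift (P := fun u _ _ => 0 < X 0 u) fun p hp => hpos p hp 0)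
    (lift (P := fun _ v _ => 0 < X 1 v) fun p hp => hpos p hp 1)
    (lift (P := fun _ _ w => 0 < X 2 w) fun p hp => hpos p hp 2)
    (lift (P := fun u v w => deriv (X 0) u * (X 1 v + X 2 w) + deriv (X 1) v * (X 0 u + X 2 w) +
      deriv (X 2) w * (X 0 u + X 1 v) = 0) fun p hp => by
        have := hE p hp
        simp only [Fin.sum_univ_three] at this
        linear_combination this)
    (by obtain ⟨p, hp, hne⟩ := hne 0; exact ⟨_, mem p hp, hne⟩)
    (by obtain ⟨p, hp, hne⟩ := hne 1; exact ⟨_, mem p hp, hne⟩)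
    (by obtain ⟨p, hp, hne⟩ := hne 2; exact ⟨_, mem p hp, by rwa [hw p hp]⟩)
  have down : ∀ {P : ℝ → ℝ → ℝ → Prop}, (∀ q ∈ Ω, P q.1 q.2 (-q.1 - q.2)) →
      ∀ x ∈ M, P (f (x 0)) (g (x 1)) (h (x 2)) := by
    intro P hP x hx
    have := hP _ (mem x hx)
    simp only [hw x hx] at this
    rwa [φ0, φ1, φ2] at this
  have hit : ∀ F : ℝ → ℝ, iteratedDeriv 3 F = deriv (deriv (deriv F)) := fun F => by
    simp [iteratedDeriv_succ, iteratedDeriv_zero]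
  have hode := down (P := fun u v w => deriv (deriv (deriv (X 0))) u = a * deriv (X 0) u ∧
    deriv (deriv (deriv (X 1))) v = a * deriv (X 1) v ∧
    deriv (deriv (deriv (X 2))) w = a * deriv (X 2) w) ha
  refine ⟨X 0, X 1, X 2, ?_, ?_, ?_, ?_, a, ?_, ?_, ?_, ?_, ?_⟩
  · intro x hx
    rw [← φ0, ← φ1, ← φ2]
    exact ⟨(hXM x hx 0).1, (hXM x hx 1).1, (hXM x hx 2).1⟩
  · intro x hx
    rw [← φ0, ← φ1, ← φ2]
    exact ⟨(hXM x hx 0).2.1, (hXM x hx 1).2.1, (hXM x hx 2).2.1⟩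
  · obtain ⟨q, hq, h1, h2, h3⟩ := hpt
    rw [hΩdef] at hq
    obtain ⟨p, hp, rfl⟩ := hq
    simp only [hw p hp] at h3
    rw [← φ0, ← φ1, ← φ2]
    exact ⟨p, hp, h1, h2, h3⟩
  · intro x hx
    rw [← φ0, ← φ1, ← φ2]
    exact ⟨(hXM x hx 0).2.2.2, (hXM x hx 1).2.2.2, (hXM x hx 2).2.2.2⟩
  · simpa only [hit] using hode
  · intro x hx
    obtain ⟨h1, h2, h3⟩ := hode x hx
    simp only [hit]
    exact ⟨fun h => by rw [h1, mul_div_assoc, div_self h, mul_one],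
      fun h => by rw [h2, mul_div_assoc, div_self h, mul_one],
      fun h => by rw [h3, mul_div_assoc, div_self h, mul_one]⟩
  · intro ha0
    obtain ⟨b, hb, hab, p, q, r, hc, H⟩ := hexp ha0
    exact ⟨b, hb, hab, p, q, r, hc, down (P := fun u v w =>
      X 0 u = p 0 + q 0 * Real.exp (b * u) + r 0 * Real.exp (-(b * u)) ∧
      X 1 v = p 1 + q 1 * Real.exp (b * v) + r 1 * Real.exp (-(b * v)) ∧
      X 2 w = p 2 + q 2 * Real.exp (b * w) + r 2 * Real.exp (-(b * w))) H⟩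
  · intro ha0
    obtain ⟨b, hb, hab, p, q, r, hc, H⟩ := htrig ha0
    exact ⟨b, hb, hab, p, q, r, hc, down (P := fun u v w =>
      X 0 u = p 0 + q 0 * Real.cos (b * u) + r 0 * Real.sin (b * u) ∧
      X 1 v = p 1 + q 1 * Real.cos (b * v) + r 1 * Real.sin (b * v) ∧
      X 2 w = p 2 + q 2 * Real.cos (b * w) + r 2 * Real.sin (b * w)) H⟩
  · intro ha0
    obtain ⟨p, q, r, hc, H⟩ := hquad ha0
    exact ⟨p, q, r, hc, down (P := fun u v w =>
      X 0 u = p 0 + q 0 * u + r 0 * u ^ 2 ∧ X 1 v = p 1 + q 1 * v + r 1 * v ^ 2 ∧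
      X 2 w = p 2 + q 2 * w + r 2 * w ^ 2) H⟩
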